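/- Fix an integer $d\ge 1$, real numbers $\alpha\in[0,1)$ and $\beta>0$, and put $\lambda(n)=1-\beta n^{-\alpha}$; assume $\lambda(n)\ge 0$ for all large $n$ (for $\alpha=0$ this means $\beta\le 1$). For each $n$ let $k(n)$ be an integer with $1\le k(n)\le n$ (for all large $n$). Consider the loss system with $n$ servers and no waiting room. Jobs arrive in a Poisson process of rate $n\lambda(n)$ and have independent exponential sizes of mean $1$. An arriving job sees a uniformly random set of $k(n)$ of the $n$ servers; if $l$ of these are idle, it occupies $\min(d,l)$ idle ones (it is lost if $l=0$). A job that occupies $i$ servers is served at rate $i$ and then frees all of them. Let $X_i$ be the number of jobs that occupy $i$ servers, $1\le i\le d$, and $x_i=X_i/n$. The vector $(X_1,\dots,X_d)$ is a continuous-time Markov chain on the finite set $\{X\in\mathbb{N}^d:\sum_i iX_i\le n\}$, with transitions $X\to X+e_i$ at rate $n\lambda(n)A_i(X)$ and $X\to X-e_i$ at rate $iX_i$. Here, with $B=\sum_i iX_i$ the number of busy servers, $A_i(X)=\binom{n-B}{i}\binom{B}{k(n)-i}/\binom{n}{k(n)}$ for $1\le i<d$ and $A_d(X)=\sum_{l\ge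 d}\binom{n-B}{l}\binom{B}{k(n)-l}/\binom{n}{k(n)}$. Let $\mathbb{E}$ be the expectation under its stationary distribution. (i) For all sufficiently large $n$, $$\mathbb{E}\big[(\lambda(n)-d\,x_d)^2\big]\le \frac{2d}{n}\lambda(n)\Big(1+\frac{2n^{\alpha}}{\beta}\Big)+\lambda(n)^2\,d\,k(n)^d\Big(1-\frac{\beta}{2n^{\alpha}}\Big)^{k(n)-d}.$$ (ii) (State space collapse.) If $k(n)^d\big(1-\frac{\beta}{2n^{\alpha}}\big)^{k(n)-d}\to 0$ as $n\to\infty$, then $\mathbb{E}[(\lambda(n)-d\,x_d)^2]\to 0$, and $\mathbb{E}[x_i]\to 0$ for every $1\le i<d$. (iii) The condition in (ii) holds if, for some constant $C>2\alpha d/\beta$, $k(n)\ge C\,n^{\alpha}\log n$ for all large $n$. -/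

import Mathlib

open Filter Topology

noncomputable section

namespace AdaptiveJobs

/-- The number of busy servers when, for each `i : Fin d`, there are `X i` jobs in service
that each occupy `i + 1` servers (the jobs occupy `1, …, d` servers). -/
def busy {d : ℕ} (X : Fin d → ℕ) : ℕ := ∑ i : Fin d, ((i : ℕ) + 1) * X i

/-- States of a system of `n` servers with jobs of maximal parallelism `d`: the numbers
`X i` of jobs that occupy `i + 1` servers, where at most `n` servers are busy. -/
def State (n d : ℕ) : Type := {X : Fin d → ℕ // busy X ≤ n}

theorem le_of_busy_le {n d : ℕ} {X : Fin d → ℕ} (h : busy X ≤ n) (i : Fin d) : X i ≤ n := by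
  refine le_trans ?_ h
  refine le_trans (Nat.le_mul_of_pos_left (X i) (Nat.succ_pos i)) ?_
  exact Finset.single_le_sum (f := fun j : Fin d => ((j : ℕ) + 1) * X j)
    (fun _ _ => Nat.zero_le _) (Finset.mem_univ i)

instance (n d : ℕ) : Finite (State n d) :=
  Finite.of_injective
    (fun (x : State n d) (i : Fin d) =>
      (⟨x.1 i, Nat.lt_succ_of_le (le_of_busy_le x.2 i)⟩ : Fin (n + 1)))
    (fun x y h => Subtype.ext (funext fun i => by
      have := congrFun h i
      simpa using this))

instance (n d : ℕ) : Fintype (State n d) := Fintype.ofFinite _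

/-- The number of idle servers. -/
def State.idle {n d : ℕ} (x : State n d) : ℕ := n - busy x.1

/-- The scaled number of jobs that occupy `i + 1` servers. -/
def State.scaled {n d : ℕ} (x : State n d) (i : Fin d) : ℝ := (x.1 i : ℝ) / n

/-- The scaled number `x_d` of jobs that occupy the maximal number `d` of servers. -/
def State.top {n d : ℕ} (hd : 1 ≤ d) (x : State n d) : ℝ :=
  x.scaled ⟨d - 1, Nat.sub_lt hd Nat.one_pos⟩

/-- The probability that exactly `j` of `k` servers, sampled uniformly without replacement
from `n` servers of which `idle` are idle, are idle (hypergeometric distribution). -/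
def sampleProb (n k idle j : ℕ) : ℝ :=
  if j ≤ k then ((idle.choose j : ℝ) * ((n - idle).choose (k - j) : ℝ)) / (n.choose k : ℝ) else 0

/-- The probability that the greedy scheme, which sees `k` uniformly sampled servers, assigns
an arriving job to exactly `j` servers, `1 ≤ j ≤ d`: for `j < d`, exactly `j` sampled servers
are idle; for `j = d`, at least `d` sampled servers are idle. (A job that sees no idle
server is lost, so that `j = 0` causes no transition.) -/
def assignProb {n d : ℕ} (k : ℕ) (x : State n d) (j : ℕ) : ℝ :=
  if j < d then sampleProb n k x.idle j else ∑ l ∈ Finset.Icc d k, sampleProb n k x.idle l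

open Classical in
/-- The transition rates of the continuous-time Markov chain: jobs arrive at rate `n * lam`
and are assigned greedily; each of the `x.1 i` jobs on `i + 1` servers has unit-mean
exponential size and so leaves at rate `i + 1`. -/
def rate {n d : ℕ} (k : ℕ) (lam : ℝ) (x y : State n d) : ℝ :=
  ∑ i : Fin d,
    ((if y.1 = x.1 + Pi.single i 1 then (n : ℝ) * lam * assignProb k x ((i : ℕ) + 1) else 0) +
      (if x.1 = y.1 + Pi.single i 1 then ((i : ℕ) + 1 : ℝ) * (x.1 i : ℝ) else 0))

/-- `π` is a stationary distribution of the chain (global balance equations). -/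
structure IsStationary {n d : ℕ} (k : ℕ) (lam : ℝ) (π : State n d → ℝ) : Prop where
  nonneg : ∀ x, 0 ≤ π x
  sum_eq_one : ∑ x, π x = 1
  balance : ∀ y, ∑ x, π x * rate k lam x y = π y * ∑ z, rate k lam y z

/-- Expectation of `f` under the weights `π`. -/
def expect {n d : ℕ} (π : State n d → ℝ) (f : State n d → ℝ) : ℝ := ∑ x, π x * f x

/-- The load `λ(n) = 1 - β n^(-α)`. -/
def load (α β : ℝ) (n : ℕ) : ℝ := 1 - β / (n : ℝ) ^ α

/-- The sampling term `k^d (1 - β / (2 n^α))^(k - d)`, with an integer exponent. -/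
def samplingTerm (d : ℕ) (α β : ℝ) (n k : ℕ) : ℝ :=
  (k : ℝ) ^ d * (1 - β / (2 * (n : ℝ) ^ α)) ^ ((k : ℤ) - (d : ℤ))

end AdaptiveJobs

end

/-!
Write `a = d x_d`, `s` for the fraction of busy servers, `λ = 1 - 2e` with `e = β / (2 n^α)`, and
`q = ∑ (d - i) x_i`, the deficit, which vanishes exactly if all jobs have `d` servers. All bounds
come from the fact that the generator of the chain has stationary mean zero
(`IsStationary.expect_gen`), for suitable test functions.

* The square of `x_d` gives `E[(λ - a)²] ≤ λ E[(λ - a)(1 - A_d)] + dλ / n`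
  (`IsStationary.expect_sq_le`). If at most a fraction `ρ` of the servers is busy, then
  `1 - A_d ≤ d k^(d-1) ρ^(k-d)` (`one_sub_assignProb_top_le`). For `ρ = 1 - e` this is the sampling
  term, up to a factor `k` that is to spare. There remain the states with `s > 1 - e`.
* There the probabilities `A_i` are out of control, but the total number of jobs decreases,
  because a busy server completes work at rate one whatever job it serves
  (`drift_jobLoad`). If on the other hand `s < 1 - 3e/2`, then the deficit decays, because hardly
  any job gets less than `d` servers (`drift_deficit_le`). The Lyapunov function `lyap` joins the two
  regimes. It is a function of `u`, a shift of `d ∑ x_i`, and `τ = s - (1 - 3e/2)`, which depends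
  only on `u` where `τ ≥ 0`, and, but for a narrow transition zone, only on the deficit where
  `τ < 0`. Being a minimum of quadratic functions, it lies below a quadratic function that touches
  it at the current state, so its generator is bounded by an exact computation for quadratics
  (`gen_lyapTest_le`). The result is `E[P min(e, P)] ≤ C / n · π(active)` for a quantity `P`
  (`excess`) that dominates half of what the deficit has above a threshold, where a state is
  active if a transition can change the Lyapunov function (`IsStationary.expect_excess_le`). Using
  the bound twice, with a lower threshold to bound the probability of the active states, gains
  another factor of order `1 / n` (`IsStationary.expect_excess_add_le`).
* If `α = 0`, then `e` is fixed, and `λ - a > 0`, `s > 1 - e` force a deficit of the order of `e`.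
  So this contribution to `E[(λ - a)²]` is `O(1 / n²)`, up to a tiny multiple of the sampling term
  (`IsStationary.expect_sq_le_of_fixed`).
* If `α > 0`, then `e → 0`, and terms of order `1 / n` are negligible compared with the term
  `1 / (n e)` of the claim. Here `λ - a` is bounded by the deficit and `|s - λ|`. The square of
  `d ∑ x_i - λ` bounds `E[(s - λ)²]` by `O(1 / n) + E[q²]`
  (`IsStationary.expect_busyFrac_sub_sq_le`), and the Lyapunov bound makes `E[q²]` a small multiple
  of `1 / (n e)` (`IsStationary.expect_sq_le_of_small`). The sampling term absorbs the errors: it is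
  trivially large unless `k` is large (`le_of_samplingTerm_lt`).

State space collapse follows because `E[∑_{i<d} i x_i] = E[s] - E[a] ≤ E[λ - a]`
(`IsStationary.expect_scaled_le`).
-/

namespace AdaptiveJobs

/-! ### The sampling probabilities -/

theorem sampleProb_nonneg (n k idle j : ℕ) : 0 ≤ sampleProb n k idle j := by
  unfold sampleProb
  split_ifs <;> positivity

theorem sampleProb_eq_zero_of_lt {n k idle j : ℕ} (h : idle < j) :
    sampleProb n k idle j = 0 := by
  unfold sampleProb
  split_ifs <;> simp [Nat.choose_eq_zero_of_lt h]

/-- Vandermonde's identity in probabilistic form. -/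
theorem sum_sampleProb {n k idle : ℕ} (hk : k ≤ n) (hi : idle ≤ n) :
    ∑ j ∈ Finset.range (k + 1), sampleProb n k idle j = 1 := by
  have hpos : (0 : ℝ) < (n.choose k : ℝ) := by exact_mod_cast Nat.choose_pos hk
  have hv := Nat.add_choose_eq idle (n - idle) k
  rw [Nat.add_sub_cancel' hi, Finset.Nat.sum_antidiagonal_eq_sum_range_succ
    (fun a b => idle.choose a * (n - idle).choose b)] at hv
  have : ∑ j ∈ Finset.range (k + 1), sampleProb n k idle j =
      ∑ j ∈ Finset.range (k + 1),
        ((idle.choose j : ℝ) * ((n - idle).choose (k - j) : ℝ)) / (n.choose k : ℝ) := by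
    refine Finset.sum_congr rfl fun j hj => ?_
    rw [sampleProb, if_pos (Nat.lt_succ_iff.mp (Finset.mem_range.mp hj))]
  rw [this, ← Finset.sum_div, div_eq_one_iff_eq hpos.ne', hv]
  push_cast
  rfl

theorem sum_sampleProb_split {n k idle : ℕ} (hk : k ≤ n) (hi : idle ≤ n) (d : ℕ) :
    ∑ j ∈ Finset.range d, sampleProb n k idle j +
      ∑ l ∈ Finset.Icc d k, sampleProb n k idle l = 1 := by
  rw [← sum_sampleProb hk hi]
  rcases le_or_gt d (k + 1) with h | h
  · rw [← Finset.sum_range_add_sum_Ico _ h]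
    congr 1
  · rw [Finset.Icc_eq_empty (by omega), Finset.sum_empty, add_zero]
    symm
    refine Finset.sum_subset (Finset.range_mono h.le) fun j _ hj => ?_
    rw [sampleProb, if_neg]
    simpa [Nat.lt_succ_iff] using hj

/-- The fraction of the `i`-subsets of an `n`-set that lie in a given `B`-subset is at most
`(B / n) ^ i`, the probability for sampling with replacement. -/
theorem choose_mul_pow_le {B n : ℕ} (h : B ≤ n) (i : ℕ) :
    (B.choose i : ℝ) * (n : ℝ) ^ i ≤ (n.choose i : ℝ) * (B : ℝ) ^ i := by
  induction i with
  | zero => simp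
  | succ i ih =>
    rcases Nat.lt_or_ge B (i + 1) with hlt | hge
    · rw [Nat.choose_eq_zero_of_lt hlt]
      simp only [Nat.cast_zero, zero_mul]
      positivity
    have hB : (B.choose (i + 1) : ℝ) * (i + 1) = B.choose i * ((B : ℝ) - i) := by
      have := Nat.choose_succ_right_eq B i
      have h2 : ((B - i : ℕ) : ℝ) = (B : ℝ) - i := Nat.cast_sub (by omega)
      rw [← h2]; exact_mod_cast this
    have hn : (n.choose (i + 1) : ℝ) * (i + 1) = n.choose i * ((n : ℝ) - i) := by
      have := Nat.choose_succ_right_eq n i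
      have h2 : ((n - i : ℕ) : ℝ) = (n : ℝ) - i := Nat.cast_sub (by omega)
      rw [← h2]; exact_mod_cast this
    have hBn : (B : ℝ) ≤ n := by exact_mod_cast h
    have hBi : (i : ℝ) + 1 ≤ B := by exact_mod_cast hge
    have hstep : ((B : ℝ) - i) * n ≤ ((n : ℝ) - i) * B := by nlinarith [Nat.cast_nonneg (α := ℝ) i]
    have hi : (0 : ℝ) < (i : ℝ) + 1 := by positivity
    refine le_of_mul_le_mul_right ?_ hi
    calc (B.choose (i + 1) : ℝ) * (n : ℝ) ^ (i + 1) * (i + 1)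
        = (B.choose i * (n : ℝ) ^ i) * (((B : ℝ) - i) * n) := by
          rw [mul_right_comm, hB, pow_succ]; ring
      _ ≤ (n.choose i * (B : ℝ) ^ i) * (((n : ℝ) - i) * B) :=
          mul_le_mul ih hstep (mul_nonneg (by linarith) (by positivity)) (by positivity)
      _ = (n.choose (i + 1) : ℝ) * (B : ℝ) ^ (i + 1) * (i + 1) := by
          rw [mul_right_comm (n.choose (i + 1) : ℝ), hn, pow_succ]; ring

/-- Sampling without replacement is dominated by the binomial weights without the factor for
the idle servers. -/
theorem sampleProb_le {n k idle j : ℕ} (hk : k ≤ n) (hi : idle ≤ n) (hj : j ≤ k) (hn : 1 ≤ n) :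
    sampleProb n k idle j ≤ (k.choose j : ℝ) * (((n - idle : ℕ) : ℝ) / n) ^ (k - j) := by
  have hpos : (0 : ℝ) < (n.choose k : ℝ) := by exact_mod_cast Nat.choose_pos hk
  have hn0 : (0 : ℝ) < n := by exact_mod_cast hn
  rw [sampleProb, if_pos hj, div_le_iff₀ hpos]
  rcases Nat.lt_or_ge (n - idle) (k - j) with hlt | hge
  · rw [Nat.choose_eq_zero_of_lt hlt]
    simp only [Nat.cast_zero, mul_zero]
    positivity
  have h1 : (idle.choose j : ℝ) ≤ ((n - (k - j)).choose j : ℝ) := by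
    exact_mod_cast Nat.choose_le_choose j (by omega : idle ≤ n - (k - j))
  have h2 : ((n - idle).choose (k - j) : ℝ) ≤
      (n.choose (k - j) : ℝ) * (((n - idle : ℕ) : ℝ) / n) ^ (k - j) := by
    rw [div_pow, ← mul_div_assoc, le_div_iff₀ (by positivity)]
    exact choose_mul_pow_le (Nat.sub_le n idle) (k - j)
  have h3 : (n.choose k : ℝ) * (k.choose j : ℝ) =
      (n.choose (k - j) : ℝ) * ((n - (k - j)).choose j : ℝ) := by
    have := Nat.choose_mul (n := n) (k := k) (s := k - j) (Nat.sub_le k j)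
    rw [Nat.choose_symm hj, Nat.sub_sub_self hj] at this
    exact_mod_cast this
  calc (idle.choose j : ℝ) * ((n - idle).choose (k - j) : ℝ)
      ≤ ((n - (k - j)).choose j : ℝ) *
          ((n.choose (k - j) : ℝ) * (((n - idle : ℕ) : ℝ) / n) ^ (k - j)) :=
        mul_le_mul h1 h2 (by positivity) (by positivity)
    _ = (k.choose j : ℝ) * (((n - idle : ℕ) : ℝ) / n) ^ (k - j) * (n.choose k : ℝ) := by
        rw [mul_right_comm, mul_comm (k.choose j : ℝ), h3]; ring

/-- If at most a fraction `ρ` of the servers is busy, then it is unlikely to sample fewer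
than `d` idle servers. -/
theorem sum_sampleProb_lt_le {n k idle d : ℕ} {ρ : ℝ} (hk : k ≤ n) (hi : idle ≤ n)
    (hd : 1 ≤ d) (hdk : d ≤ k) (hρ : ((n - idle : ℕ) : ℝ) / n ≤ ρ) (hρ1 : ρ ≤ 1) :
    ∑ j ∈ Finset.range d, sampleProb n k idle j ≤
      (d : ℝ) * ((k : ℝ) ^ (d - 1) * ρ ^ (k - d)) := by
  have hρ0 : 0 ≤ ρ := le_trans (by positivity) hρ
  have hk1 : (1 : ℝ) ≤ k := by exact_mod_cast hd.trans hdk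
  have : ∀ j ∈ Finset.range d, sampleProb n k idle j ≤ (k : ℝ) ^ (d - 1) * ρ ^ (k - d) := by
    intro j hj
    have hjd := Finset.mem_range.mp hj
    refine (sampleProb_le hk hi (by omega) (by omega)).trans ?_
    refine mul_le_mul ?_ ?_ (by positivity) (by positivity)
    · have : (k.choose j : ℝ) ≤ (k : ℝ) ^ j := by exact_mod_cast Nat.choose_le_pow k j
      exact this.trans (pow_le_pow_right₀ hk1 (by omega))
    · exact (pow_le_pow_left₀ (by positivity) hρ _).trans
        (pow_le_pow_of_le_one hρ0 hρ1 (by omega))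
  refine (Finset.sum_le_card_nsmul _ _ _ this).trans ?_
  simp

variable {n d : ℕ}

theorem idle_le (x : State n d) : x.idle ≤ n := Nat.sub_le _ _

theorem sub_idle (x : State n d) : n - x.idle = busy x.1 := Nat.sub_sub_self x.2

theorem assignProb_nonneg (k : ℕ) (x : State n d) (j : ℕ) : 0 ≤ assignProb k x j := by
  unfold assignProb
  split_ifs
  · exact sampleProb_nonneg _ _ _ _
  · exact Finset.sum_nonneg fun _ _ => sampleProb_nonneg _ _ _ _

/-- A job is never assigned to more servers than are idle. -/
theorem assignProb_eq_zero {k : ℕ} {x : State n d} {j : ℕ} (hj : j ≤ d) (h : x.idle < j) :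
    assignProb k x j = 0 := by
  unfold assignProb
  split_ifs
  · exact sampleProb_eq_zero_of_lt h
  · refine Finset.sum_eq_zero fun l hl => sampleProb_eq_zero_of_lt ?_
    have := (Finset.mem_Icc.mp hl).1
    omega

/-- The probability that an arriving job is lost. -/
noncomputable def lossProb (k : ℕ) (x : State n d) : ℝ := sampleProb n k x.idle 0

theorem lossProb_nonneg (k : ℕ) (x : State n d) : 0 ≤ lossProb k x := sampleProb_nonneg _ _ _ _

theorem assignProb_top_eq (k : ℕ) (x : State n d) (hk : k ≤ n) :
    assignProb k x d = 1 - ∑ j ∈ Finset.range d, sampleProb n k x.idle j := by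
  rw [assignProb, if_neg (lt_irrefl d), ← sum_sampleProb_split hk (idle_le x) d]
  ring

/-- The job is either lost or assigned to some number of servers. -/
theorem sum_assignProb (hd : 1 ≤ d) {k : ℕ} (hk : k ≤ n) (x : State n d) :
    ∑ i : Fin d, assignProb k x ((i : ℕ) + 1) = 1 - lossProb k x := by
  obtain ⟨e, rfl⟩ : ∃ e, d = e + 1 := ⟨d - 1, by omega⟩
  rw [Fin.sum_univ_castSucc, Fin.val_last, assignProb_top_eq k x hk, Finset.sum_range_succ']
  have : ∑ i : Fin e, assignProb k x ((Fin.castSucc i : ℕ) + 1) =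
      ∑ j ∈ Finset.range e, sampleProb n k x.idle (j + 1) := by
    rw [Finset.sum_range]
    refine Finset.sum_congr rfl fun i _ => ?_
    rw [assignProb, if_pos (by simp)]
    rfl
  rw [this, lossProb]
  ring

theorem one_sub_assignProb_top_le (hd : 1 ≤ d) {k : ℕ} (hk : k ≤ n) (hdk : d ≤ k)
    (x : State n d) {ρ : ℝ} (hρ : (busy x.1 : ℝ) / n ≤ ρ) (hρ1 : ρ ≤ 1) :
    1 - assignProb k x d ≤ (d : ℝ) * ((k : ℝ) ^ (d - 1) * ρ ^ (k - d)) := by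
  rw [assignProb_top_eq k x hk, sub_sub_cancel]
  refine sum_sampleProb_lt_le hk (idle_le x) hd hdk ?_ hρ1
  rwa [sub_idle]

theorem assignProb_top_le_one (k : ℕ) (hk : k ≤ n) (x : State n d) : assignProb k x d ≤ 1 := by
  rw [assignProb_top_eq k x hk]
  have : 0 ≤ ∑ j ∈ Finset.range d, sampleProb n k x.idle j :=
    Finset.sum_nonneg fun _ _ => sampleProb_nonneg _ _ _ _
  linarith

theorem assignProb_top_le_one_sub_lossProb (hd : 1 ≤ d) (k : ℕ) (hk : k ≤ n) (x : State n d) :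
    lossProb k x ≤ 1 - assignProb k x d := by
  rw [assignProb_top_eq k x hk, sub_sub_cancel]
  exact Finset.single_le_sum (f := fun j => sampleProb n k x.idle j)
    (fun _ _ => sampleProb_nonneg _ _ _ _) (Finset.mem_range.mpr hd)

end AdaptiveJobs

namespace AdaptiveJobs

/-! ### The generator and stationary expectations -/

variable {n d : ℕ}

/-- The generator of the chain, applied to a function on all of `ℕ^d`. At a state with no job
of type `i` the truncated subtraction is harmless, since the rate of that departure is zero. -/
noncomputable def gen (k : ℕ) (lam : ℝ) (f : (Fin d → ℕ) → ℝ) (x : State n d) : ℝ :=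
  ∑ i : Fin d,
    ((n : ℝ) * lam * assignProb k x ((i : ℕ) + 1) * (f (x.1 + Pi.single i 1) - f x.1) +
      ((i : ℕ) + 1 : ℝ) * (x.1 i : ℝ) * (f (x.1 - Pi.single i 1) - f x.1))

theorem busy_add_single (X : Fin d → ℕ) (i : Fin d) :
    busy (X + Pi.single i 1) = busy X + (i + 1) := by
  unfold busy
  simp only [Pi.add_apply, mul_add, Finset.sum_add_distrib]
  congr 1
  rw [Finset.sum_eq_single i]
  · simp
  · intro j _ hj
    simp [hj]
  · simp

theorem sub_add_single {X : Fin d → ℕ} {i : Fin d} (h : X i ≠ 0) :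
    X - Pi.single i 1 + Pi.single i 1 = X := by
  funext j
  by_cases hj : j = i
  · subst hj
    simp
    omega
  · simp [hj]

open Classical in
theorem sum_rate_mul_sub (k : ℕ) (lam : ℝ) (f : (Fin d → ℕ) → ℝ) (x : State n d) :
    ∑ y : State n d, rate k lam x y * (f y.1 - f x.1) = gen k lam f x := by
  unfold rate gen
  simp only [Finset.sum_mul]
  rw [Finset.sum_comm]
  refine Finset.sum_congr rfl fun i _ => ?_
  refine ((Finset.sum_congr rfl fun y _ => add_mul _ _ _).trans Finset.sum_add_distrib).trans ?_
  congr 1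
  · by_cases hb : busy (x.1 + Pi.single i 1) ≤ n
    · refine (Finset.sum_eq_single (⟨x.1 + Pi.single i 1, hb⟩ : State n d) ?_ ?_).trans ?_
      · intro y _ hy
        rw [if_neg, zero_mul]
        exact fun h => hy (Subtype.ext h)
      · exact fun h => (h (Finset.mem_univ (α := State n d) _)).elim
      · simp
    -- The arrival would leave the state space, but then fewer than `i + 1` servers are idle.
    · have h0 : assignProb k x ((i : ℕ) + 1) = 0 := by
        refine assignProb_eq_zero i.2 ?_
        rw [busy_add_single] at hb
        have := x.2
        unfold State.idle
        omega
      simp [h0]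
  · by_cases h0 : x.1 i = 0
    · simp [h0]
    · have hx := sub_add_single h0
      have hb : busy (x.1 - Pi.single i 1) ≤ n := by
        have h1 := busy_add_single (x.1 - Pi.single i 1) i
        have h2 := x.2
        rw [hx] at h1
        omega
      refine (Finset.sum_eq_single (⟨x.1 - Pi.single i 1, hb⟩ : State n d) ?_ ?_).trans ?_
      · intro y _ hy
        rw [if_neg, zero_mul]
        intro h
        refine hy (Subtype.ext ?_)
        simp [h]
      · exact fun h => (h (Finset.mem_univ (α := State n d) _)).elim
      · simp [hx]

section Expect

variable (π : State n d → ℝ)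

theorem expect_add (f g : State n d → ℝ) :
    expect π (fun x => f x + g x) = expect π f + expect π g := by
  simp only [expect, mul_add, Finset.sum_add_distrib]

theorem expect_sub (f g : State n d → ℝ) :
    expect π (fun x => f x - g x) = expect π f - expect π g := by
  simp only [expect, mul_sub, Finset.sum_sub_distrib]

theorem expect_const_mul (c : ℝ) (f : State n d → ℝ) :
    expect π (fun x => c * f x) = c * expect π f := by
  simp only [expect, Finset.mul_sum]
  exact Finset.sum_congr rfl fun _ _ => by ring

end Expect

namespace IsStationary

variable {k : ℕ} {lam : ℝ} {π : State n d → ℝ}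

theorem expect_const (h : IsStationary k lam π) (c : ℝ) : expect π (fun _ => c) = c := by
  simp only [expect, ← Finset.sum_mul, h.sum_eq_one, one_mul]

theorem expect_mono (h : IsStationary k lam π) {f g : State n d → ℝ} (hfg : ∀ x, f x ≤ g x) :
    expect π f ≤ expect π g :=
  Finset.sum_le_sum fun x _ => mul_le_mul_of_nonneg_left (hfg x) (h.nonneg x)

theorem expect_nonneg (h : IsStationary k lam π) {f : State n d → ℝ} (hf : ∀ x, 0 ≤ f x) :
    0 ≤ expect π f :=
  Finset.sum_nonneg fun x _ => mul_nonneg (h.nonneg x) (hf x)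

theorem sq_expect_le (h : IsStationary k lam π) (f : State n d → ℝ) :
    expect π f ^ 2 ≤ expect π (fun x => f x ^ 2) := by
  have h1 := h.expect_nonneg (f := fun x => (f x - expect π f) ^ 2) fun x => sq_nonneg _
  have h2 : (fun x => (f x - expect π f) ^ 2) =
      fun x => (f x ^ 2 - 2 * expect π f * f x) + expect π f ^ 2 := by
    funext x
    ring
  rw [h2, expect_add, expect_sub, expect_const_mul, h.expect_const] at h1
  linarith

/-- In stationarity the generator has mean zero. -/
theorem expect_gen (h : IsStationary k lam π) (f : (Fin d → ℕ) → ℝ) :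
    expect π (gen k lam f) = 0 := by
  unfold expect
  simp only [← sum_rate_mul_sub, mul_sub, Finset.sum_sub_distrib, Finset.mul_sum]
  rw [Finset.sum_comm, sub_eq_zero]
  refine Finset.sum_congr rfl fun y _ => ?_
  have hy := h.balance y
  calc ∑ x, π x * (rate k lam x y * f y.1) = (∑ x, π x * rate k lam x y) * f y.1 := by
        rw [Finset.sum_mul]
        exact Finset.sum_congr rfl fun _ _ => by ring
    _ = ∑ z, π y * (rate k lam y z * f y.1) := by
        rw [hy, Finset.mul_sum, Finset.sum_mul]
        exact Finset.sum_congr rfl fun _ _ => by ring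

end IsStationary

/-- Replacing the test function by an upper bound that is exact at the current state can only
increase the generator. -/
theorem gen_mono {k : ℕ} {lam : ℝ} (hlam : 0 ≤ lam) {f g : (Fin d → ℕ) → ℝ} {x : State n d}
    (hx : f x.1 = g x.1) (hfg : ∀ X, f X ≤ g X) : gen k lam f x ≤ gen k lam g x := by
  unfold gen
  refine Finset.sum_le_sum fun i _ => add_le_add ?_ ?_
  · have := assignProb_nonneg k x ((i : ℕ) + 1)
    refine mul_le_mul_of_nonneg_left ?_ (by positivity)
    linarith [hfg (x.1 + Pi.single i 1)]
  · refine mul_le_mul_of_nonneg_left ?_ (by positivity)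
    linarith [hfg (x.1 - Pi.single i 1)]

/-- The scaled linear functional `(∑ i, c i * X i) / n`. -/
noncomputable def lin (n : ℕ) (c : Fin d → ℝ) (X : Fin d → ℕ) : ℝ := (∑ i, c i * (X i : ℝ)) / n

/-- The drift of the linear functional `lin n c`. -/
noncomputable def drift (k : ℕ) (lam : ℝ) (c : Fin d → ℝ) (x : State n d) : ℝ :=
  ∑ i : Fin d, c i * (lam * assignProb k x ((i : ℕ) + 1) - ((i : ℕ) + 1 : ℝ) * x.scaled i)

/-- The quadratic variation rate of the linear functional `lin n c`, multiplied by `n`. -/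
noncomputable def noise (k : ℕ) (lam : ℝ) (c : Fin d → ℝ) (x : State n d) : ℝ :=
  ∑ i : Fin d, c i ^ 2 * (lam * assignProb k x ((i : ℕ) + 1) + ((i : ℕ) + 1 : ℝ) * x.scaled i)

theorem lin_add_single (c : Fin d → ℝ) (X : Fin d → ℕ) (i : Fin d) :
    lin n c (X + Pi.single i 1) = lin n c X + c i / n := by
  unfold lin
  rw [← add_div]
  congr 1
  simp only [Pi.add_apply, Nat.cast_add, mul_add, Finset.sum_add_distrib]
  congr 1
  rw [Finset.sum_eq_single i]
  · simp
  · intro j _ hj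
    simp [hj]
  · simp

theorem lin_sub_single (c : Fin d → ℝ) {X : Fin d → ℕ} {i : Fin d} (h : X i ≠ 0) :
    lin n c (X - Pi.single i 1) = lin n c X - c i / n := by
  have := lin_add_single (n := n) c (X - Pi.single i 1) i
  rw [sub_add_single h] at this
  linarith

theorem lin_eq_sum_scaled (c : Fin d → ℝ) (x : State n d) :
    lin n c x.1 = ∑ i, c i * x.scaled i := by
  unfold lin State.scaled
  rw [Finset.sum_div]
  exact Finset.sum_congr rfl fun _ _ => by ring

theorem gen_lin (hn : 1 ≤ n) (k : ℕ) (lam : ℝ) (c : Fin d → ℝ) (x : State n d) :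
    gen k lam (lin n c) x = drift k lam c x := by
  have hn0 : (n : ℝ) ≠ 0 := by positivity
  unfold gen drift State.scaled
  refine Finset.sum_congr rfl fun i _ => ?_
  rw [lin_add_single]
  by_cases h : x.1 i = 0
  · simp only [h]
    field_simp
    simp
    ring
  · rw [lin_sub_single c h]
    field_simp
    ring

theorem gen_sq (hn : 1 ≤ n) (k : ℕ) (lam : ℝ) (c : Fin d → ℝ) (a : ℝ) (x : State n d) :
    gen k lam (fun X => (lin n c X + a) ^ 2) x =
      2 * (lin n c x.1 + a) * drift k lam c x + noise k lam c x / n := by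
  have hn0 : (n : ℝ) ≠ 0 := by positivity
  unfold gen drift noise State.scaled
  rw [Finset.mul_sum, Finset.sum_div, ← Finset.sum_add_distrib]
  refine Finset.sum_congr rfl fun i _ => ?_
  beta_reduce
  rw [lin_add_single]
  by_cases h : x.1 i = 0
  · simp only [h]
    field_simp
    simp
    ring
  · rw [lin_sub_single c h]
    field_simp
    ring

theorem gen_add (k : ℕ) (lam : ℝ) (f g : (Fin d → ℕ) → ℝ) (b : ℝ) (x : State n d) :
    gen k lam (fun X => f X + b * g X) x = gen k lam f x + b * gen k lam g x := by
  unfold gen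
  rw [Finset.mul_sum, ← Finset.sum_add_distrib]
  exact Finset.sum_congr rfl fun i _ => by ring

end AdaptiveJobs

namespace AdaptiveJobs

/-! ### First and second moment identities -/

variable {n d : ℕ}

/-- The fraction of busy servers. -/
noncomputable def busyFrac (x : State n d) : ℝ := lin n (fun i : Fin d => ((i : ℕ) + 1 : ℝ)) x.1

/-- The scaled number of jobs, times `d`. -/
noncomputable def jobLoad (x : State n d) : ℝ := lin n (fun _ : Fin d => (d : ℝ)) x.1

/-- The fraction of servers that the present jobs would occupy in addition if each of them had
`d` servers. It vanishes exactly if all jobs have maximal parallelism. -/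
noncomputable def deficit (x : State n d) : ℝ :=
  lin n (fun i : Fin d => (d : ℝ) - ((i : ℕ) + 1 : ℝ)) x.1

theorem jobLoad_eq (x : State n d) : jobLoad x = deficit x + busyFrac x := by
  simp only [jobLoad, deficit, busyFrac, lin_eq_sum_scaled, ← Finset.sum_add_distrib]
  exact Finset.sum_congr rfl fun _ _ => by ring

theorem scaled_nonneg (x : State n d) (i : Fin d) : 0 ≤ x.scaled i := by
  unfold State.scaled
  positivity

theorem busyFrac_eq (x : State n d) : busyFrac x = (busy x.1 : ℝ) / n := by
  unfold busyFrac lin busy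
  push_cast
  rfl

theorem busyFrac_nonneg (x : State n d) : 0 ≤ busyFrac x := by
  rw [busyFrac_eq]
  positivity

theorem busyFrac_le_one (x : State n d) : busyFrac x ≤ 1 := by
  rw [busyFrac_eq]
  refine div_le_one_of_le₀ ?_ (by positivity)
  exact_mod_cast x.2

theorem deficit_nonneg (x : State n d) : 0 ≤ deficit x := by
  rw [deficit, lin_eq_sum_scaled]
  refine Finset.sum_nonneg fun i _ => mul_nonneg ?_ (scaled_nonneg x i)
  have : ((i : ℕ) + 1 : ℝ) ≤ d := by exact_mod_cast i.2
  linarith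

theorem jobLoad_le (x : State n d) : jobLoad x ≤ d := by
  have h : jobLoad x ≤ d * busyFrac x := by
    simp only [jobLoad, busyFrac, lin_eq_sum_scaled, Finset.mul_sum]
    refine Finset.sum_le_sum fun i _ => ?_
    have h1 := scaled_nonneg x i
    have h2 : (0 : ℝ) ≤ d * ((i : ℕ) : ℝ) * x.scaled i := by positivity
    nlinarith
  have := mul_le_mul_of_nonneg_left (busyFrac_le_one x) (Nat.cast_nonneg (α := ℝ) d)
  linarith

theorem top_nonneg (hd : 1 ≤ d) (x : State n d) : 0 ≤ x.top hd := scaled_nonneg _ _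

theorem top_succ {e : ℕ} (hd : 1 ≤ e + 1) (x : State n (e + 1)) :
    x.top hd = x.scaled (Fin.last e) := rfl

theorem busyFrac_sub_top (hd : 1 ≤ d) (x : State n d) :
    busyFrac x - d * x.top hd = ∑ i : Fin d,
      (if (i : ℕ) + 1 < d then ((i : ℕ) + 1 : ℝ) * x.scaled i else 0) := by
  obtain ⟨e, rfl⟩ : ∃ e, d = e + 1 := ⟨d - 1, by omega⟩
  rw [busyFrac, lin_eq_sum_scaled, Fin.sum_univ_castSucc, Fin.sum_univ_castSucc, top_succ]
  simp

theorem busyFrac_sub_top_nonneg (hd : 1 ≤ d) (x : State n d) :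
    0 ≤ busyFrac x - d * x.top hd := by
  rw [busyFrac_sub_top]
  refine Finset.sum_nonneg fun i _ => ?_
  have := scaled_nonneg x i
  split_ifs <;> positivity

/-- The servers that are busy with jobs of less than maximal parallelism. -/
theorem busyFrac_sub_top_le (hd : 1 ≤ d) (x : State n d) :
    busyFrac x - d * x.top hd ≤ ((d : ℝ) - 1) * deficit x := by
  rw [busyFrac_sub_top, deficit, lin_eq_sum_scaled, Finset.mul_sum]
  refine Finset.sum_le_sum fun i _ => ?_
  have hx := scaled_nonneg x i
  split_ifs with h
  · have h1 : ((i : ℕ) + 1 : ℝ) + 1 ≤ d := by exact_mod_cast h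
    have h0 : (0 : ℝ) ≤ ((i : ℕ) : ℝ) := Nat.cast_nonneg _
    rw [← mul_assoc]
    refine mul_le_mul_of_nonneg_right ?_ hx
    nlinarith
  · have h1 : ((i : ℕ) + 1 : ℝ) ≤ d := by exact_mod_cast i.2
    have h2 : (1 : ℝ) ≤ d := by exact_mod_cast hd
    exact mul_nonneg (by linarith) (mul_nonneg (by linarith) hx)

theorem scaled_le_busyFrac_sub_top (hd : 1 ≤ d) (x : State n d) {i : Fin d}
    (hi : (i : ℕ) + 1 < d) : x.scaled i ≤ busyFrac x - d * x.top hd := by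
  rw [busyFrac_sub_top]
  refine le_trans ?_ (Finset.single_le_sum (f := fun j : Fin d =>
    (if (j : ℕ) + 1 < d then ((j : ℕ) + 1 : ℝ) * x.scaled j else 0)) ?_ (Finset.mem_univ i))
  · simp only [if_pos hi]
    have h0 : (0 : ℝ) ≤ ((i : ℕ) : ℝ) := Nat.cast_nonneg _
    nlinarith [scaled_nonneg x i]
  · intro j _
    have := scaled_nonneg x j

    split_ifs <;> positivity

/-- The number of jobs grows at the rate of accepted arrivals and falls at the rate given by the
number of busy servers, whatever the parallelism of the jobs. -/
theorem drift_jobLoad (hd : 1 ≤ d) {k : ℕ} (hk : k ≤ n) (lam : ℝ) (x : State n d) :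
    drift k lam (fun _ => (d : ℝ)) x = d * (lam * (1 - lossProb k x) - busyFrac x) := by
  rw [← sum_assignProb hd hk x, busyFrac, lin_eq_sum_scaled, drift, Finset.mul_sum,
    ← Finset.sum_sub_distrib, Finset.mul_sum]

theorem noise_jobLoad (hd : 1 ≤ d) {k : ℕ} (hk : k ≤ n) (lam : ℝ) (x : State n d) :
    noise k lam (fun _ => (d : ℝ)) x = d ^ 2 * (lam * (1 - lossProb k x) + busyFrac x) := by
  rw [← sum_assignProb hd hk x, busyFrac, lin_eq_sum_scaled, noise, Finset.mul_sum,
    ← Finset.sum_add_distrib, Finset.mul_sum]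

theorem noise_busyFrac_le (hd : 1 ≤ d) {k : ℕ} (hk : k ≤ n) {lam : ℝ} (hlam : 0 ≤ lam)
    (x : State n d) : noise k lam (fun i => ((i : ℕ) + 1 : ℝ)) x ≤
      d ^ 2 * (lam * (1 - lossProb k x) + busyFrac x) := by
  rw [← noise_jobLoad hd hk]
  refine Finset.sum_le_sum fun i _ => ?_
  have h1 : ((i : ℕ) + 1 : ℝ) ≤ d := by exact_mod_cast i.2
  have h2 := assignProb_nonneg k x ((i : ℕ) + 1)
  have h3 := scaled_nonneg x i
  exact mul_le_mul_of_nonneg_right (pow_le_pow_left₀ (by positivity) h1 2) (by positivity)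

/-- The deficit is refilled only by jobs that do not get `d` servers, and decays at rate at least
one. -/
theorem drift_deficit_le (hd : 1 ≤ d) {k : ℕ} (hk : k ≤ n) {lam : ℝ} (hlam : 0 ≤ lam)
    (x : State n d) : drift k lam (fun i => (d : ℝ) - ((i : ℕ) + 1 : ℝ)) x ≤
      ((d : ℝ) - 1) * lam * (1 - assignProb k x d) - deficit x := by
  have hA : 1 - assignProb k x d - lossProb k x =
      ∑ i : Fin d, (if (i : ℕ) + 1 < d then assignProb k x ((i : ℕ) + 1) else 0) := by
    have := sum_assignProb hd hk x
    obtain ⟨e, rfl⟩ : ∃ e, d = e + 1 := ⟨d - 1, by omega⟩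
    rw [Fin.sum_univ_castSucc] at this ⊢
    simp at this ⊢
    linarith
  have h1d : (1 : ℝ) ≤ d := by exact_mod_cast hd
  have hsum : drift k lam (fun i => (d : ℝ) - ((i : ℕ) + 1 : ℝ)) x ≤
      ((d : ℝ) - 1) * lam * (1 - assignProb k x d - lossProb k x) - deficit x := by
    rw [hA, deficit, lin_eq_sum_scaled, drift, Finset.mul_sum, ← Finset.sum_sub_distrib]
    refine Finset.sum_le_sum fun i _ => ?_
    have h0 : (0 : ℝ) ≤ ((i : ℕ) : ℝ) := Nat.cast_nonneg _
    have hx := scaled_nonneg x i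
    have hp := assignProb_nonneg k x ((i : ℕ) + 1)
    split_ifs with h
    · have h1 : ((i : ℕ) + 1 : ℝ) + 1 ≤ d := by exact_mod_cast h
      have h2 : 0 ≤ ((d : ℝ) - (((i : ℕ) : ℝ) + 1)) * (((i : ℕ) : ℝ) * x.scaled i) :=
        mul_nonneg (by linarith) (by positivity)
      have h3 : 0 ≤ ((i : ℕ) : ℝ) * (lam * assignProb k x ((i : ℕ) + 1)) := by positivity
      nlinarith
    · have h1 : ((i : ℕ) + 1 : ℝ) = d := by
        have := i.2
        exact_mod_cast (by omega : (i : ℕ) + 1 = d)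
      simp [h1]
  have hl := lossProb_nonneg k x
  have : 0 ≤ ((d : ℝ) - 1) * lam * lossProb k x :=
    mul_nonneg (mul_nonneg (by linarith) hlam) hl
  linarith

theorem drift_top (hd : 1 ≤ d) (k : ℕ) (lam : ℝ) (x : State n d) :
    drift k lam (Pi.single ⟨d - 1, Nat.sub_lt hd Nat.one_pos⟩ 1) x =
      lam * assignProb k x d - d * x.top hd := by
  rw [drift, Finset.sum_eq_single ⟨d - 1, Nat.sub_lt hd Nat.one_pos⟩]
  · have : d - 1 + 1 = d := by omega
    have h2 : ((d - 1 : ℕ) : ℝ) + 1 = d := by exact_mod_cast this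
    simp [this, h2, State.top]
  · intro j _ hj
    simp [hj]
  · simp

theorem noise_top (hd : 1 ≤ d) (k : ℕ) (lam : ℝ) (x : State n d) :
    noise k lam (Pi.single ⟨d - 1, Nat.sub_lt hd Nat.one_pos⟩ 1) x =
      lam * assignProb k x d + d * x.top hd := by
  rw [noise, Finset.sum_eq_single ⟨d - 1, Nat.sub_lt hd Nat.one_pos⟩]
  · have : d - 1 + 1 = d := by omega
    have h2 : ((d - 1 : ℕ) : ℝ) + 1 = d := by exact_mod_cast this
    simp [this, h2, State.top]
  · intro j _ hj
    simp [hj]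
  · simp

theorem lin_top (hd : 1 ≤ d) (x : State n d) :
    lin n (Pi.single ⟨d - 1, Nat.sub_lt hd Nat.one_pos⟩ 1) x.1 = x.top hd := by
  rw [lin_eq_sum_scaled, Finset.sum_eq_single ⟨d - 1, Nat.sub_lt hd Nat.one_pos⟩]
  · simp [State.top]
  · intro j _ hj
    simp [hj]
  · simp

namespace IsStationary

variable {k : ℕ} {lam : ℝ} {π : State n d → ℝ}

theorem expect_top (h : IsStationary k lam π) (hd : 1 ≤ d) (hn : 1 ≤ n) :
    expect π (fun x => lam * assignProb k x d - d * x.top hd) = 0 := by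
  rw [← h.expect_gen (lin n (Pi.single ⟨d - 1, Nat.sub_lt hd Nat.one_pos⟩ 1))]
  congr 1
  funext x
  rw [gen_lin hn, drift_top]

/-- The equilibrium of flow in the number of jobs. -/
theorem expect_busyFrac (h : IsStationary k lam π) (hd : 1 ≤ d) (hn : 1 ≤ n) (hk : k ≤ n) :
    expect π (fun x => lam * (1 - lossProb k x) - busyFrac x) = 0 := by
  have h1 := h.expect_gen (lin n (fun _ => (d : ℝ)))
  have h2 : gen k lam (lin n (fun _ : Fin d => (d : ℝ))) =
      fun x : State n d => (d : ℝ) * (lam * (1 - lossProb k x) - busyFrac x) := by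
    funext x
    rw [gen_lin hn, drift_jobLoad hd hk]
  rw [h2, expect_const_mul] at h1
  have hd0 : (d : ℝ) ≠ 0 := by positivity
  exact (mul_eq_zero.mp h1).resolve_left hd0

/-- The mean square of `lam - d x_d` is governed by the jobs that do not get `d` servers. -/
theorem expect_sq_le (h : IsStationary k lam π) (hd : 1 ≤ d) (hn : 1 ≤ n) (hk : k ≤ n)
    (hlam : 0 ≤ lam) :
    expect π (fun x => (lam - d * x.top hd) ^ 2) ≤
      lam * expect π (fun x => (lam - d * x.top hd) * (1 - assignProb k x d)) + d * lam / n := by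
  have h1 := h.expect_top hd hn
  have h2 := h.expect_gen
    (fun X => (lin n (Pi.single ⟨d - 1, Nat.sub_lt hd Nat.one_pos⟩ 1) X + 0) ^ 2)
  have h3 : expect π (fun x : State n d =>
      (lam - d * x.top hd) ^ 2 - lam * ((lam - d * x.top hd) * (1 - assignProb k x d))) ≤
      d * lam / n := by
    -- The difference is a combination of the generators of `x_d` and `x_d ^ 2`, which have mean
    -- zero, up to a multiple of `1 / n`.
    calc _ = expect π (fun x : State n d => ((lam - d / (2 * n)) *
              (lam * assignProb k x d - d * x.top hd) + (-(d / 2 : ℝ)) *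
              gen k lam (fun X =>
                (lin n (Pi.single ⟨d - 1, Nat.sub_lt hd Nat.one_pos⟩ 1) X + 0) ^ 2) x) +
              d * lam / n * assignProb k x d) := by
          congr 1
          funext x
          rw [gen_sq hn, drift_top hd, noise_top hd, lin_top hd]
          field_simp
          ring
      _ = d * lam / n * expect π (fun x => assignProb k x d) := by
          rw [expect_add, expect_add, expect_const_mul, expect_const_mul, expect_const_mul, h1]
          rw [h2]
          ring
      _ ≤ d * lam / n * expect π (fun _ => 1) :=
          mul_le_mul_of_nonneg_left
            (h.expect_mono fun x => assignProb_top_le_one k hk x) (by positivity)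
      _ = d * lam / n := by rw [h.expect_const, mul_one]
  rw [expect_sub, expect_const_mul] at h3
  linarith

/-- The fluctuations of the fraction of busy servers are of order `1 / n`, up to the
deficit. -/
theorem expect_busyFrac_sub_sq_le (h : IsStationary k lam π) (hd : 1 ≤ d) (hn : 1 ≤ n)
    (hk : k ≤ n) (hlam : 0 ≤ lam) {δ : ℝ} (hδ0 : 0 ≤ δ)
    (hδ : ∀ x : State n d, busyFrac x ≤ lam → lossProb k x ≤ δ) :
    expect π (fun x => (busyFrac x - lam) ^ 2) ≤
      2 * d * lam / n + expect π (fun x => deficit x ^ 2) + 2 * lam ^ 2 * δ := by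
  have hd0 : (0 : ℝ) < d := by exact_mod_cast hd
  have hn0 : (0 : ℝ) < n := by exact_mod_cast hn
  have h1 := h.expect_busyFrac hd hn hk
  have h2 := h.expect_gen (fun X => (lin n (fun _ => (d : ℝ)) X + (-lam)) ^ 2)
  have h3 : expect π (fun x : State n d =>
      (busyFrac x - lam) ^ 2 - deficit x ^ 2) ≤ 2 * d * lam / n + 2 * lam ^ 2 * δ := by
    -- The test functions are the number of jobs and the square of its deviation.
    calc _ ≤ expect π (fun x : State n d => (-(1 / d : ℝ)) *
              gen k lam (fun X => (lin n (fun _ => (d : ℝ)) X + (-lam)) ^ 2) x +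
              (-(d / n : ℝ)) * (lam * (1 - lossProb k x) - busyFrac x) +
              (2 * d * lam / n + 2 * lam ^ 2 * δ)) := by
          refine h.expect_mono fun x => ?_
          rw [gen_sq hn, drift_jobLoad hd hk, noise_jobLoad hd hk]
          change _ ≤ -(1 / d : ℝ) * (2 * (jobLoad x + -lam) * _ + _) + _ + _
          rw [jobLoad_eq]
          have hq := deficit_nonneg x
          have hl := lossProb_nonneg k x
          have hs := busyFrac_nonneg x
          have key : -(lam ^ 2 * δ) ≤ (busyFrac x - lam) * (lam * lossProb k x) := by
            rcases le_total (busyFrac x) lam with hle | hle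
            · have h5 : (lam - busyFrac x) * (lam * lossProb k x) ≤ lam * (lam * δ) :=
                mul_le_mul (by linarith) (mul_le_mul_of_nonneg_left (hδ x hle) hlam)
                  (by positivity) hlam
              nlinarith
            · have : 0 ≤ (busyFrac x - lam) * (lam * lossProb k x) :=
                mul_nonneg (by linarith) (by positivity)
              have : 0 ≤ lam ^ 2 * δ := by positivity
              linarith
          have hql : 0 ≤ deficit x * (lam * lossProb k x) := by positivity
          have hln : 0 ≤ 2 * d * lam / n * lossProb k x := by positivity
          have hsq := sq_nonneg (deficit x + (busyFrac x - lam))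
          have e1 : -(1 / d : ℝ) * (2 * (deficit x + busyFrac x + -lam) *
              (d * (lam * (1 - lossProb k x) - busyFrac x)) +
              d ^ 2 * (lam * (1 - lossProb k x) + busyFrac x) / n) +
              -(d / n : ℝ) * (lam * (1 - lossProb k x) - busyFrac x) =
              2 * (deficit x + (busyFrac x - lam)) * ((busyFrac x - lam) + lam * lossProb k x)
                - 2 * d * lam / n + 2 * d * lam / n * lossProb k x := by
            field_simp
            ring
          rw [e1]
          nlinarith
      _ = 2 * d * lam / n + 2 * lam ^ 2 * δ := by
          rw [expect_add, expect_add, expect_const_mul, expect_const_mul, h.expect_const, h1, h2]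
          ring
  rw [expect_sub] at h3
  linarith

end IsStationary

end AdaptiveJobs

namespace AdaptiveJobs

/-! ### The Lyapunov function -/

/-- The minimizing shift in the definition of `lyap`. -/
noncomputable def lyapShift (g u τ : ℝ) : ℝ := max 0 (max (-u) (-((u - τ) / (1 + g)) - τ))

/-- The main coordinate of the Lyapunov function, `max u 0 ((u - τ) * g / (1 + g))`. -/
noncomputable def lyapMain (g u τ : ℝ) : ℝ := u + lyapShift g u τ

/-- The side coordinate of the Lyapunov function. -/
noncomputable def lyapSide (g u τ : ℝ) : ℝ := max 0 (-(τ + lyapShift g u τ))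

/-- The Lyapunov function, as a function of two real variables: the minimum of
`(u + ξ) ^ 2 + g * (τ + ξ - η) ^ 2` over `ξ, η ≥ 0`, see `lyap_le` and `lyap_eq`. -/
noncomputable def lyap (g u τ : ℝ) : ℝ := lyapMain g u τ ^ 2 + g * lyapSide g u τ ^ 2

section

variable {g : ℝ} (u τ : ℝ)

theorem lyapShift_nonneg (g : ℝ) : 0 ≤ lyapShift g u τ := le_max_left _ _

theorem lyapSide_nonneg (g : ℝ) : 0 ≤ lyapSide g u τ := le_max_left _ _

theorem lyapMain_nonneg (g : ℝ) : 0 ≤ lyapMain g u τ := by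
  have : -u ≤ lyapShift g u τ := (le_max_left _ _).trans (le_max_right _ _)
  unfold lyapMain
  linarith

theorem le_lyapMain (g : ℝ) : u ≤ lyapMain g u τ := by
  have := lyapShift_nonneg u τ g
  unfold lyapMain
  linarith

theorem sub_div_le_lyapMain (g : ℝ) : (u - τ) - (u - τ) / (1 + g) ≤ lyapMain g u τ := by
  have : -((u - τ) / (1 + g)) - τ ≤ lyapShift g u τ := (le_max_right _ _).trans (le_max_right _ _)
  unfold lyapMain
  linarith

theorem lyapShift_cases (g : ℝ) : lyapShift g u τ = 0 ∨ lyapShift g u τ = -u ∨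
    lyapShift g u τ = -((u - τ) / (1 + g)) - τ := by
  unfold lyapShift
  rcases max_choice (0 : ℝ) (max (-u) (-((u - τ) / (1 + g)) - τ)) with h | h
  · exact Or.inl h
  · rw [h]
    exact Or.inr (max_choice _ _)

theorem half_le_lyapMain (hg : 1 ≤ g) : (u - τ) / 2 ≤ lyapMain g u τ := by
  rcases le_total (u - τ) 0 with h | h
  · have := lyapMain_nonneg u τ g
    linarith
  · have h1 := sub_div_le_lyapMain u τ g
    have h2 : (u - τ) / (1 + g) ≤ (u - τ) / 2 :=
      div_le_div_of_nonneg_left h (by norm_num) (by linarith)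
    linarith

theorem lyapMain_le (hg : 0 < g) {D : ℝ} (hD : 0 ≤ D) (hu : u ≤ D) (hp : u - τ ≤ D) :
    lyapMain g u τ ≤ D := by
  have hb : (0 : ℝ) < 1 + g := by linarith
  unfold lyapMain
  rcases lyapShift_cases u τ g with h | h | h <;> rw [h]
  · linarith
  · linarith
  · have h1 : (u - τ) - (u - τ) / (1 + g) = (u - τ) * (g / (1 + g)) := by
      field_simp
      ring
    have h2 : g / (1 + g) ≤ 1 := (div_le_one hb).mpr (by linarith)
    have h3 : 0 ≤ g / (1 + g) := by positivity
    nlinarith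

theorem lyapMain_add_le (hg : 0 < g) {h : ℝ} (hh : 0 ≤ h) :
    lyapMain g (u + h) τ ≤ lyapMain g u τ + h := by
  have h1 := le_lyapMain u τ g
  have h2 := lyapMain_nonneg u τ g
  have h3 := sub_div_le_lyapMain u τ g
  rcases lyapShift_cases (u + h) τ g with e | e | e
  · rw [lyapMain, e]
    linarith
  · rw [lyapMain, e]
    linarith
  · rw [lyapMain, e]
    have h4 : (u + h - τ) / (1 + g) = (u - τ) / (1 + g) + h / (1 + g) := by
      rw [← add_div]
      ring
    have h5 : 0 ≤ h / (1 + g) := div_nonneg hh (by linarith)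
    linarith

theorem mul_lyapSide_le (hg : 0 < g) : g * lyapSide g u τ ≤ lyapMain g u τ := by
  have hb : (0 : ℝ) < 1 + g := by linarith
  have h0 := lyapMain_nonneg u τ g
  have h1 : -((u - τ) / (1 + g)) - τ ≤ lyapShift g u τ :=
    (le_max_right _ _).trans (le_max_right _ _)
  have h2 : (1 + g) * (-((u - τ) / (1 + g)) - τ) = -u - g * τ := by
    field_simp
    ring
  have h3 := mul_le_mul_of_nonneg_left h1 hb.le
  rw [h2] at h3
  unfold lyapSide
  rcases max_choice 0 (-(τ + lyapShift g u τ)) with e | e <;> rw [e]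
  · simpa using h0
  · unfold lyapMain
    linarith

/-- Complementary slackness for the shift. -/
theorem lyap_slackness (hg : 0 < g) :
    (lyapMain g u τ - g * lyapSide g u τ) * lyapShift g u τ = 0 := by
  have hb : (0 : ℝ) < 1 + g := by linarith
  have hM := lyapMain_nonneg u τ g
  have hS := lyapSide_nonneg u τ g
  have hle := mul_lyapSide_le u τ hg
  rcases lyapShift_cases u τ g with e | e | e
  · rw [e, mul_zero]
  · have h0 : lyapMain g u τ = 0 := by
      rw [lyapMain, e]
      ring
    have h1 : 0 ≤ g * lyapSide g u τ := by positivity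
    rw [h0] at hle ⊢
    rw [le_antisymm hle h1]
    ring
  · have h2 : (1 + g) * (-((u - τ) / (1 + g)) - τ) = -u - g * τ := by
      field_simp
      ring
    rw [← e] at h2
    have h3 : lyapMain g u τ = g * (-(τ + lyapShift g u τ)) := by
      rw [lyapMain]
      linarith
    have h4 : 0 ≤ -(τ + lyapShift g u τ) := by
      rw [h3] at hM
      exact nonneg_of_mul_nonneg_right hM hg
    have h5 : lyapSide g u τ = -(τ + lyapShift g u τ) := max_eq_right h4
    rw [h5, ← h3, sub_self, zero_mul]

theorem lyap_le (hg : 0 < g) {ξ η : ℝ} (hξ : 0 ≤ ξ) (hη : 0 ≤ η) :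
    lyap g u τ ≤ (u + ξ) ^ 2 + g * (τ + ξ - η) ^ 2 := by
  have hM := lyapMain_nonneg u τ g
  have hS := lyapSide_nonneg u τ g
  have hle := mul_lyapSide_le u τ hg
  have hsl := lyap_slackness u τ hg
  have h1 : lyapMain g u τ ^ 2 + 2 * lyapMain g u τ * (ξ - lyapShift g u τ) ≤ (u + ξ) ^ 2 := by
    have := sq_nonneg (ξ - lyapShift g u τ)
    have e : u = lyapMain g u τ - lyapShift g u τ := by
      rw [lyapMain]
      ring
    have e2 : u + ξ = lyapMain g u τ + (ξ - lyapShift g u τ) := by linarith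
    rw [e2]
    nlinarith
  have h2 : lyapSide g u τ ^ 2 - 2 * lyapSide g u τ * (ξ - lyapShift g u τ) ≤
      (τ + ξ - η) ^ 2 := by
    have h3 : lyapSide g u τ * (τ + lyapShift g u τ + lyapSide g u τ) = 0 := by
      unfold lyapSide
      rcases max_choice 0 (-(τ + lyapShift g u τ)) with e | e <;> rw [e] <;> ring
    have h4 := sq_nonneg (τ + ξ - η + lyapSide g u τ)
    have h5 := mul_nonneg hS hη
    nlinarith
  have h3 := mul_le_mul_of_nonneg_left h2 hg.le
  have h4 := mul_nonneg (sub_nonneg.mpr hle) hξ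
  unfold lyap
  nlinarith

theorem lyap_eq : lyap g u τ = (u + lyapShift g u τ) ^ 2 +
    g * (τ + lyapShift g u τ - max 0 (τ + lyapShift g u τ)) ^ 2 := by
  unfold lyap lyapMain lyapSide
  rcases le_total 0 (τ + lyapShift g u τ) with h | h
  · rw [max_eq_right h, max_eq_left (by linarith)]
    ring
  · rw [max_eq_left h, max_eq_right (by linarith)]
    ring

theorem lyap_eq_zero (hg : 0 < g) (hu : u ≤ 0) (hp : u - τ ≤ 0) :
    lyapMain g u τ = 0 ∧ lyap g u τ = 0 := by
  have h0 : lyapMain g u τ = 0 :=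
    le_antisymm (lyapMain_le u τ hg le_rfl hu hp) (lyapMain_nonneg u τ g)
  have h1 := mul_lyapSide_le u τ hg
  have h2 : 0 ≤ g * lyapSide g u τ := mul_nonneg hg.le (lyapSide_nonneg u τ g)
  have h3 : lyapSide g u τ = 0 := by
    rw [h0] at h1
    exact (mul_eq_zero.mp (le_antisymm h1 h2)).resolve_left hg.ne'
  exact ⟨h0, by rw [lyap, h0, h3]; ring⟩

/-- The negative drift of the Lyapunov function. Where `τ ≥ 0` only the first drift `M` enters,
which is at most `-d * eps / 2` there; where `τ < 0` the drift `q` of `u - τ` compensates for the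
growth of `u`. -/
theorem lyap_drift_le {d eps M q : ℝ} (hd : 1 ≤ d) (heps : 0 < eps)
    (hM : M ≤ -(d * (τ + eps / 2))) (hq : τ < 0 → q ≤ -(u - τ)) :
    2 * (lyapMain (2 * d) u τ - 2 * d * lyapSide (2 * d) u τ) * M +
        2 * (2 * d) * lyapSide (2 * d) u τ * q ≤
      -(1 / 2) * (lyapMain (2 * d) u τ * min eps (lyapMain (2 * d) u τ)) := by
  have hg : 0 < 2 * d := by linarith
  have hP := lyapMain_nonneg u τ (2 * d)
  have hT := lyapSide_nonneg u τ (2 * d)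
  have hle := mul_lyapSide_le u τ hg
  have hsl := lyap_slackness u τ hg
  have hξ := lyapShift_nonneg u τ (2 * d)
  have hPdef : lyapMain (2 * d) u τ = u + lyapShift (2 * d) u τ := rfl
  have hTdef : lyapSide (2 * d) u τ = max 0 (-(τ + lyapShift (2 * d) u τ)) := rfl
  set P := lyapMain (2 * d) u τ
  set T := lyapSide (2 * d) u τ
  set ξ := lyapShift (2 * d) u τ
  have hmin1 : P * min eps P ≤ P * eps := mul_le_mul_of_nonneg_left (min_le_left _ _) hP
  have hmin2 : P * min eps P ≤ P * P := mul_le_mul_of_nonneg_left (min_le_right _ _) hP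
  have hmin0 : 0 ≤ P * eps := by positivity
  rcases hT.eq_or_lt with h0 | hpos
  · rw [← h0] at hsl ⊢
    rcases hP.eq_or_lt with hP0 | hP0
    · rw [← hP0]
      simp
    · have hξ0 : ξ = 0 := by
        refine (mul_eq_zero.mp hsl).resolve_left ?_
        simpa using hP0.ne'
      have hτ : 0 ≤ τ := by
        have : -(τ + ξ) ≤ T := hTdef ▸ le_max_right _ _
        rw [hξ0, ← h0] at this
        linarith
      -- no shift is needed, so `τ ≥ 0` and the total number of jobs decreases
      have h1 : M ≤ -(eps / 2) := by nlinarith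
      nlinarith
  · have hTeq : T = -(τ + ξ) := by
      rw [hTdef]
      refine max_eq_right ?_
      by_contra hneg
      rw [hTdef, max_eq_left (by linarith)] at hpos
      exact lt_irrefl _ hpos
    have hτ : τ < 0 := by linarith
    have hq' := hq hτ
    have hp : P + T = u - τ := by rw [hPdef, hTeq]; ring
    have hTq : T * q ≤ T * (-(P + T)) := mul_le_mul_of_nonneg_left (by linarith) hT
    rcases hξ.eq_or_lt with hξ0 | hξ0
    -- The transition zone: the decay of the deficit, with weight `T`, and the drift of the number
    -- of jobs, with weight `P - 2 * d * T`, take turns in being dominant.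
    · have hτT : τ = -T := by linarith
      have hPM : (P - 2 * d * T) * M ≤ (P - 2 * d * T) * (-(d * (τ + eps / 2))) :=
        mul_le_mul_of_nonneg_left hM (by linarith)
      rw [hτT] at hPM
      have h1 : 2 * (P - 2 * d * T) * M + 2 * (2 * d) * T * q ≤
          -(2 * d * T * P) - (P - 2 * d * T) * (d * eps) := by
        have e1 : 0 ≤ d * T * T := by positivity
        have e2 : 0 ≤ d * (d * T * T) := by positivity
        have e3 : d * (T * q) ≤ d * (T * (-(P + T))) :=
          mul_le_mul_of_nonneg_left hTq (by linarith)
        nlinarith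
      rcases le_total (P / 2) (2 * d * T) with h2 | h2
      · have e4 : P / 2 * P ≤ 2 * d * T * P := mul_le_mul_of_nonneg_right h2 hP
        have e5 : 0 ≤ (P - 2 * d * T) * (d * eps) :=
          mul_nonneg (by linarith) (by positivity)
        linarith
      · have e4 : P / 2 * (1 * eps) ≤ (P - 2 * d * T) * (d * eps) :=
          mul_le_mul (by linarith) (mul_le_mul_of_nonneg_right hd heps.le) (by positivity)
            (by linarith)
        have e5 : 0 ≤ 2 * d * T * P := by positivity
        linarith
    -- Far below `τ = 0` the Lyapunov function depends only on the deficit.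
    · have hPT : P - 2 * d * T = 0 := (mul_eq_zero.mp hsl).resolve_right hξ0.ne'
      rw [hPT]
      have e3 : 2 * d * (T * q) ≤ 2 * d * (T * (-(P + T))) :=
        mul_le_mul_of_nonneg_left hTq (by linarith)
      have e4 : 2 * d * T = P := by linarith
      have e5 : 2 * d * (T * (-(P + T))) = -(P * (P + T)) := by
        rw [← e4]
        ring
      have e6 : 0 ≤ P * T := by positivity
      nlinarith

end

/-! ### Drift of the Lyapunov function under the chain -/

variable {n d : ℕ}

/-- The first argument of the Lyapunov function at a state. -/
noncomputable def lyapU (lam eps c : ℝ) (x : State n d) : ℝ := jobLoad x - (lam + eps / 2 + c)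

/-- The second argument of the Lyapunov function at a state. -/
noncomputable def lyapτ (lam eps : ℝ) (x : State n d) : ℝ := busyFrac x - (lam + eps / 2)

theorem lyapU_sub_lyapτ (lam eps c : ℝ) (x : State n d) :
    lyapU lam eps c x - lyapτ lam eps x = deficit x - c := by
  rw [lyapU, lyapτ, jobLoad_eq]
  ring

/-- The main coordinate of the Lyapunov function at a state. -/
noncomputable def excess (lam eps c : ℝ) (x : State n d) : ℝ :=
  lyapMain (2 * d) (lyapU lam eps c x) (lyapτ lam eps x)

/-- The states at which the Lyapunov function can change in one transition. -/
def lyapActive (lam eps c : ℝ) (x : State n d) : Prop :=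
  -((d : ℝ) / n) < lyapU lam eps c x ∨ -((d : ℝ) / n) < deficit x - c

/-- The Lyapunov function as a test function for the generator. -/
noncomputable def lyapTest (n : ℕ) (lam eps c : ℝ) (X : Fin d → ℕ) : ℝ :=
  lyap (2 * d) (lin n (fun _ => (d : ℝ)) X - (lam + eps / 2 + c))
    (lin n (fun i => ((i : ℕ) + 1 : ℝ)) X - (lam + eps / 2))

theorem gen_lyapTest_le (hd : 1 ≤ d) (hn : 1 ≤ n) {k : ℕ} (hk : k ≤ n) {lam eps δ c : ℝ}
    (hlam : 0 ≤ lam) (hlam1 : lam ≤ 1) (heps : 0 < eps)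
    (hc : ((d : ℝ) - 1) * lam * δ ≤ c) (x : State n d)
    (hδ : busyFrac x < lam + eps / 2 → 1 - assignProb k x d ≤ δ) :
    gen k lam (lyapTest n lam eps c) x ≤
      -(1 / 2) * (excess lam eps c x * min eps (excess lam eps c x)) + 6 * d ^ 3 / n := by
  have hd1 : (1 : ℝ) ≤ d := by exact_mod_cast hd
  have hn0 : (0 : ℝ) < n := by exact_mod_cast hn
  have hg : 0 < 2 * (d : ℝ) := by linarith
  set u := lyapU lam eps c x
  set τ := lyapτ lam eps x
  set ξ := lyapShift (2 * d) u τ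
  have hξ : 0 ≤ ξ := lyapShift_nonneg u τ _
  set η := max 0 (τ + ξ)
  have hη : 0 ≤ η := le_max_left _ _
  -- the quadratic function that touches the Lyapunov function from above at `x`
  have h1 : gen k lam (lyapTest n lam eps c) x ≤ gen k lam (fun X =>
      (lin n (fun _ => (d : ℝ)) X + (-(lam + eps / 2 + c) + ξ)) ^ 2 + 2 * d *
        (lin n (fun i => ((i : ℕ) + 1 : ℝ)) X + (-(lam + eps / 2) + ξ - η)) ^ 2) x := by
    refine gen_mono hlam ?_ fun X => ?_
    · refine (lyap_eq u τ).trans ?_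
      simp only [u, τ, lyapU, lyapτ, jobLoad, busyFrac, η, ξ]
      ring
    · refine (lyap_le _ _ hg hξ hη).trans (le_of_eq ?_)
      ring
  refine h1.trans ?_
  rw [gen_add, gen_sq hn, gen_sq hn]
  have hlm := lossProb_nonneg k x
  have hM : drift k lam (fun _ => (d : ℝ)) x ≤ -(d * (τ + eps / 2)) := by
    rw [drift_jobLoad hd hk]
    have : lam * (1 - lossProb k x) - busyFrac x ≤ -(τ + eps / 2) := by
      simp only [τ, lyapτ]
      nlinarith
    nlinarith
  have hq : τ < 0 → drift k lam (fun i => (d : ℝ) - ((i : ℕ) + 1 : ℝ)) x ≤ -(u - τ) := by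
    intro hτ
    have h2 := hδ (by simp only [τ, lyapτ] at hτ; linarith)
    have h3 := drift_deficit_le hd hk hlam x
    have h4 : ((d : ℝ) - 1) * lam * (1 - assignProb k x d) ≤ ((d : ℝ) - 1) * lam * δ :=
      mul_le_mul_of_nonneg_left h2 (mul_nonneg (by linarith) hlam)
    have h5 := lyapU_sub_lyapτ lam eps c x
    simp only [u, τ]
    linarith
  have hdr := lyap_drift_le u τ hd1 heps hM hq
  have hS : drift k lam (fun i => ((i : ℕ) + 1 : ℝ)) x = drift k lam (fun _ => (d : ℝ)) x -
      drift k lam (fun i => (d : ℝ) - ((i : ℕ) + 1 : ℝ)) x := by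
    unfold drift
    rw [← Finset.sum_sub_distrib]
    exact Finset.sum_congr rfl fun _ _ => by ring
  have hside : lin n (fun i : Fin d => ((i : ℕ) + 1 : ℝ)) x.1 + (-(lam + eps / 2) + ξ - η) =
      -lyapSide (2 * d) u τ := by
    have e : τ + ξ - η = -lyapSide (2 * d) u τ := by
      simp only [lyapSide, η]
      change τ + ξ - max 0 (τ + ξ) = -max 0 (-(τ + ξ))
      rcases le_total 0 (τ + ξ) with h | h
      · rw [max_eq_right h, max_eq_left (by linarith)]
        ring
      · rw [max_eq_left h, max_eq_right (by linarith)]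
        ring
    rw [← e]
    simp only [τ, lyapτ, busyFrac]
    ring
  have hmain : lin n (fun _ : Fin d => (d : ℝ)) x.1 + (-(lam + eps / 2 + c) + ξ) =
      lyapMain (2 * d) u τ := by
    change _ = u + ξ
    simp only [u, lyapU, jobLoad]
    ring
  have hnoise : noise k lam (fun _ => (d : ℝ)) x + 2 * d *
      noise k lam (fun i => ((i : ℕ) + 1 : ℝ)) x ≤ 6 * d ^ 3 := by
    have e1 := noise_busyFrac_le hd hk hlam x
    rw [noise_jobLoad hd hk]
    have e2 : lam * (1 - lossProb k x) + busyFrac x ≤ 2 := by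
      have := busyFrac_le_one x
      nlinarith
    have e3 := mul_le_mul_of_nonneg_left e2 (by positivity : (0 : ℝ) ≤ d ^ 2)
    have e4 := mul_le_mul_of_nonneg_left (e1.trans e3) hg.le
    have e5 : (d : ℝ) ^ 2 * 1 ≤ d ^ 2 * d := mul_le_mul_of_nonneg_left hd1 (by positivity)
    nlinarith
  have hnoise' := div_le_div_of_nonneg_right hnoise hn0.le
  rw [hside, hmain, hS]
  change _ ≤ -(1 / 2) * (lyapMain (2 * d) u τ * min eps (lyapMain (2 * d) u τ)) + _
  rw [add_div, mul_div_assoc] at hnoise'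
  linarith

theorem gen_lyapTest_eq_zero (hd : 1 ≤ d) (hn : 1 ≤ n) {k : ℕ} {lam eps c : ℝ} {x : State n d}
    (hx : ¬ lyapActive lam eps c x) :
    excess lam eps c x = 0 ∧ gen k lam (lyapTest n lam eps c) x = 0 := by
  have hd1 : (1 : ℝ) ≤ d := by exact_mod_cast hd
  have hn0 : (0 : ℝ) < n := by exact_mod_cast hn
  have hg : 0 < 2 * (d : ℝ) := by linarith
  rw [lyapActive, not_or, not_lt, not_lt, ← lyapU_sub_lyapτ lam eps c] at hx
  obtain ⟨hu, hp⟩ := hx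
  have hdn : 0 < (d : ℝ) / n := by positivity
  simp only [lyapU, lyapτ, jobLoad, busyFrac] at hu hp
  have hx0 : lyapTest n lam eps c x.1 = 0 :=
    (lyap_eq_zero _ _ hg (by linarith) (by linarith)).2
  refine ⟨(lyap_eq_zero _ _ hg ?_ ?_).1, ?_⟩
  · simp only [lyapU, jobLoad]
    linarith
  · simp only [lyapU, lyapτ, jobLoad, busyFrac]
    linarith
  refine Finset.sum_eq_zero fun i _ => ?_
  have hi0 : (0 : ℝ) ≤ (((i : ℕ) : ℝ) + 1) / n := by positivity
  have hid : (((i : ℕ) : ℝ) + 1) / n ≤ d / n := by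
    refine div_le_div_of_nonneg_right ?_ hn0.le
    exact_mod_cast i.2
  have hplus : lyapTest n lam eps c (x.1 + Pi.single i 1) = 0 := by
    unfold lyapTest
    rw [lin_add_single, lin_add_single]
    exact (lyap_eq_zero _ _ hg (by linarith) (by linarith)).2
  rw [hx0, hplus]
  by_cases h0 : x.1 i = 0
  · simp [h0]
  · have hminus : lyapTest n lam eps c (x.1 - Pi.single i 1) = 0 := by
      unfold lyapTest
      rw [lin_sub_single _ h0, lin_sub_single _ h0]
      exact (lyap_eq_zero _ _ hg (by linarith) (by linarith)).2
    rw [hminus]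
    ring

open Classical in
/-- The stationary excess is bounded in terms of the probability of the active states. -/
theorem IsStationary.expect_excess_le {k : ℕ} {lam : ℝ} {π : State n d → ℝ}
    (h : IsStationary k lam π) (hd : 1 ≤ d) (hn : 1 ≤ n) (hk : k ≤ n) {eps δ c : ℝ}
    (hlam : 0 ≤ lam) (hlam1 : lam ≤ 1) (heps : 0 < eps)
    (hδ : ∀ x : State n d, busyFrac x < lam + eps / 2 → 1 - assignProb k x d ≤ δ)
    (hc : ((d : ℝ) - 1) * lam * δ ≤ c) :
    expect π (fun x => excess lam eps c x * min eps (excess lam eps c x)) ≤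
      12 * d ^ 3 / n * expect π (fun x => if lyapActive lam eps c x then 1 else 0) := by
  have h1 : 0 ≤ expect π (fun x : State n d =>
      -(1 / 2) * (excess lam eps c x * min eps (excess lam eps c x)) +
        6 * d ^ 3 / n * (if lyapActive lam eps c x then 1 else 0)) := by
    refine (h.expect_gen (lyapTest n lam eps c)).symm.le.trans ?_
    refine h.expect_mono fun x => ?_
    split_ifs with hx
    · rw [mul_one]
      exact gen_lyapTest_le hd hn hk hlam hlam1 heps hc x (hδ x)
    · obtain ⟨e1, e2⟩ := gen_lyapTest_eq_zero (k := k) hd hn hx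
      rw [e1, e2]
      simp
  rw [expect_add, expect_const_mul, expect_const_mul] at h1
  have e : (12 * d ^ 3 / n : ℝ) = 2 * (6 * d ^ 3 / n) := by ring
  rw [e]
  linarith

end AdaptiveJobs

namespace AdaptiveJobs

/-! ### Bounds for the excess and the mean square error -/

variable {n d : ℕ}

theorem excess_nonneg (lam eps c : ℝ) (x : State n d) : 0 ≤ excess lam eps c x :=
  lyapMain_nonneg _ _ _

theorem excess_le {lam eps c : ℝ} (hd : 1 ≤ d) (hlam : 0 ≤ lam) (heps : 0 ≤ eps) (hc : 0 ≤ c)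
    (x : State n d) : excess lam eps c x ≤ d := by
  have hg : 0 < 2 * (d : ℝ) := by positivity
  have h1 := jobLoad_le x
  refine lyapMain_le _ _ hg (by positivity) ?_ ?_
  · rw [lyapU]
    linarith
  · rw [lyapU_sub_lyapτ]
    have h2 := busyFrac_nonneg x
    rw [jobLoad_eq] at h1
    linarith

theorem excess_le_excess_add {lam eps c h : ℝ} (hd : 1 ≤ d) (hh : 0 ≤ h) (x : State n d) :
    excess lam eps c x ≤ excess lam eps (c + h) x + h := by
  have hg : 0 < 2 * (d : ℝ) := by positivity
  have := lyapMain_add_le (lyapU lam eps (c + h) x) (lyapτ lam eps x) hg hh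
  have e : lyapU lam eps (c + h) x + h = lyapU lam eps c x := by
    simp only [lyapU]
    ring
  rwa [e] at this

theorem deficit_le (hd : 1 ≤ d) (lam eps c : ℝ) (x : State n d) :
    deficit x ≤ 2 * excess lam eps c x + c := by
  have h1 : (1 : ℝ) ≤ d := by exact_mod_cast hd
  have := half_le_lyapMain (g := 2 * d) (lyapU lam eps c x) (lyapτ lam eps x) (by linarith)
  rw [lyapU_sub_lyapτ] at this
  unfold excess
  linarith

theorem excess_ge_of_active {lam eps c h : ℝ} (hd : 1 ≤ d) (hh : 2 * d / n ≤ h)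
    {x : State n d} (hx : lyapActive lam eps (c + h) x) : h / 4 ≤ excess lam eps c x := by
  have h1 : (1 : ℝ) ≤ d := by exact_mod_cast hd
  have h0 : 0 ≤ h := le_trans (by positivity) hh
  rw [mul_div_assoc] at hh
  rcases hx with hx | hx
  · have h2 := le_lyapMain (lyapU lam eps c x) (lyapτ lam eps x) (2 * d)
    have e : lyapU lam eps (c + h) x + h = lyapU lam eps c x := by
      simp only [lyapU]
      ring
    unfold excess
    linarith
  · have := deficit_le hd lam eps c x
    linarith

namespace IsStationary

variable {k : ℕ} {lam : ℝ} {π : State n d → ℝ} {eps δ : ℝ}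

/-- The bound of `expect_excess_le` at the lowest admissible threshold, with the probability of
the active states bounded by one. -/
theorem expect_excess_le_const (h : IsStationary k lam π) (hd : 1 ≤ d) (hn : 1 ≤ n) (hk : k ≤ n)
    (hlam : 0 ≤ lam) (hlam1 : lam ≤ 1) (heps : 0 < eps)
    (hδ : ∀ x : State n d, busyFrac x < lam + eps / 2 → 1 - assignProb k x d ≤ δ) :
    expect π (fun x => excess lam eps (((d : ℝ) - 1) * lam * δ) x *
      min eps (excess lam eps (((d : ℝ) - 1) * lam * δ) x)) ≤ 12 * d ^ 3 / n := by
  classical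
  refine (h.expect_excess_le hd hn hk hlam hlam1 heps hδ le_rfl).trans ?_
  have : expect π (fun x => if lyapActive lam eps (((d : ℝ) - 1) * lam * δ) x
      then (1 : ℝ) else 0) ≤ 1 := by
    refine le_trans (h.expect_mono (g := fun _ => 1) fun x => ?_) (h.expect_const 1).le
    split_ifs <;> norm_num
  exact mul_le_of_le_one_right (by positivity) this

/-- Raising the threshold by `t` improves the bound for the excess by a factor of the order of
`1 / n`, since the active states of the higher threshold have a large excess over the lower
one. -/
theorem expect_excess_add_le (h : IsStationary k lam π) (hd : 1 ≤ d) (hn : 1 ≤ n) (hk : k ≤ n)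
    (hlam : 0 ≤ lam) (hlam1 : lam ≤ 1) (heps : 0 < eps)
    (hδ : ∀ x : State n d, busyFrac x < lam + eps / 2 → 1 - assignProb k x d ≤ δ)
    {t : ℝ} (ht : 2 * d / n ≤ t) :
    expect π (fun x => excess lam eps (((d : ℝ) - 1) * lam * δ + t) x *
      min eps (excess lam eps (((d : ℝ) - 1) * lam * δ + t) x)) ≤
      (12 * d ^ 3 / n) * ((12 * d ^ 3 / n) / (t / 4 * min eps (t / 4))) := by
  classical
  have hd1 : (0 : ℝ) < d := by exact_mod_cast hd
  have hn0 : (0 : ℝ) < n := by exact_mod_cast hn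
  have ht0 : 0 < t := lt_of_lt_of_le (by positivity) ht
  have hm : 0 < t / 4 * min eps (t / 4) := mul_pos (by linarith) (lt_min heps (by linarith))
  refine (h.expect_excess_le hd hn hk hlam hlam1 heps hδ
    (le_add_of_nonneg_right ht0.le)).trans ?_
  refine mul_le_mul_of_nonneg_left ?_ (by positivity)
  rw [le_div_iff₀ hm, mul_comm, ← expect_const_mul]
  refine le_trans (h.expect_mono fun x => ?_)
    (h.expect_excess_le_const hd hn hk hlam hlam1 heps hδ)
  have h0 := excess_nonneg lam eps (((d : ℝ) - 1) * lam * δ) x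
  split_ifs with hx
  · have h1 := excess_ge_of_active hd ht hx
    rw [mul_one]
    exact mul_le_mul h1 (min_le_min_left _ h1) (le_min heps.le (by linarith)) h0
  · rw [mul_zero]
    exact mul_nonneg h0 (le_min heps.le h0)

/-- The mean square bound for a fixed load: states with more than a fraction `1 - eps` of busy
servers and `d x_d < lam` have a deficit of the order of `eps`, which is very unlikely. -/
theorem expect_sq_le_of_fixed (h : IsStationary k lam π) (hd : 1 ≤ d) (hn : 1 ≤ n) (hk : k ≤ n)
    (hlam : 0 ≤ lam) (heps : 0 < eps) (hle : lam = 1 - 2 * eps) {δ' : ℝ} (hδ0 : 0 ≤ δ)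
    (hδ : ∀ x : State n d, busyFrac x < lam + eps / 2 → 1 - assignProb k x d ≤ δ)
    (hδ' : ∀ x : State n d, busyFrac x ≤ 1 - eps → 1 - assignProb k x d ≤ δ')
    (hδδ : ((d : ℝ) - 1) ^ 2 * δ ≤ δ') (hnd : 2 * d / n ≤ eps / (4 * d))
    (hnl : 32 * (12 * d ^ 3) ^ 2 / (eps / (4 * d)) ^ 3 ≤ (n : ℝ)) :
    expect π (fun x => (lam - d * x.top hd) ^ 2) ≤ 2 * d / n * lam + lam ^ 2 * δ' := by
  have hd1 : (1 : ℝ) ≤ d := by exact_mod_cast hd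
  have hn0 : (0 : ℝ) < n := by exact_mod_cast hn
  have hlam1 : lam ≤ 1 := by linarith
  set t := eps / (4 * d) with ht
  have ht0 : 0 < t := by positivity
  have htd : 4 * d * t = eps := by
    rw [ht]
    field_simp
  have htl : t ≤ eps := by nlinarith
  have hexc := h.expect_excess_add_le hd hn hk hlam hlam1 heps hδ hnd
  rw [min_eq_right (by linarith : t / 4 ≤ eps)] at hexc
  set c0 := ((d : ℝ) - 1) * lam * δ with hc0
  have hc00 : 0 ≤ c0 := mul_nonneg (mul_nonneg (by linarith) hlam) hδ0
  have hδ'0 : 0 ≤ δ' := le_trans (by positivity) hδδ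
  have hw : expect π (fun x => (lam - d * x.top hd) * (1 - assignProb k x d)) ≤
      expect π (fun x => 2 * d / t * (excess lam eps (c0 + t) x *
        min eps (excess lam eps (c0 + t) x)) + lam * δ') := by
    refine h.expect_mono fun x => ?_
    have hA1 := assignProb_top_le_one k hk x
    have hA0 := assignProb_nonneg k x d
    have ha := top_nonneg hd x
    have hda : 0 ≤ d * x.top hd := by positivity
    have hE := excess_nonneg lam eps (c0 + t) x
    have hEm : 0 ≤ excess lam eps (c0 + t) x * min eps (excess lam eps (c0 + t) x) :=
      mul_nonneg hE (le_min heps.le hE)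
    have hEm' : 0 ≤ 2 * d / t * (excess lam eps (c0 + t) x *
        min eps (excess lam eps (c0 + t) x)) := by positivity
    rcases le_or_gt (busyFrac x) (1 - eps) with hs | hs
    · have h1 := hδ' x hs
      have h2 : (lam - d * x.top hd) * (1 - assignProb k x d) ≤ lam * δ' :=
        mul_le_mul (by linarith) h1 (by linarith) hlam
      linarith
    · have hE2 : excess lam eps (c0 + t) x ≤ t + (excess lam eps (c0 + t) x *
          min eps (excess lam eps (c0 + t) x)) / t := by
        rcases le_total (excess lam eps (c0 + t) x) t with h3 | h3
        · have : 0 ≤ (excess lam eps (c0 + t) x *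
            min eps (excess lam eps (c0 + t) x)) / t := by positivity
          linarith
        · have : excess lam eps (c0 + t) x ≤ (excess lam eps (c0 + t) x *
              min eps (excess lam eps (c0 + t) x)) / t := by
            rw [le_div_iff₀ ht0]
            exact mul_le_mul_of_nonneg_left (le_min htl h3) hE
          linarith
      have hr := busyFrac_sub_top_le hd x
      have hq := deficit_le hd lam eps (c0 + t) x
      have hq2 : deficit x ≤ 2 * (t + (excess lam eps (c0 + t) x *
          min eps (excess lam eps (c0 + t) x)) / t) + (c0 + t) := by linarith
      have hq3 := mul_le_mul_of_nonneg_left hq2 (by linarith : (0 : ℝ) ≤ (d : ℝ) - 1)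
      have hc1 : ((d : ℝ) - 1) * c0 ≤ lam * δ' := by
        have := mul_le_mul_of_nonneg_left hδδ hlam
        rw [hc0]
        nlinarith
      have hEt : 0 ≤ (excess lam eps (c0 + t) x *
          min eps (excess lam eps (c0 + t) x)) / t := by positivity
      have h4 : lam - d * x.top hd ≤ 2 * d / t * (excess lam eps (c0 + t) x *
          min eps (excess lam eps (c0 + t) x)) + lam * δ' := by
        have e : 2 * d / t * (excess lam eps (c0 + t) x *
          min eps (excess lam eps (c0 + t) x)) = 2 * d * ((excess lam eps (c0 + t) x *
          min eps (excess lam eps (c0 + t) x)) / t) := by ring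
        rw [e]
        nlinarith
      have hpos : 0 ≤ 2 * d / t * (excess lam eps (c0 + t) x *
          min eps (excess lam eps (c0 + t) x)) + lam * δ' := by positivity
      calc (lam - d * x.top hd) * (1 - assignProb k x d)
          ≤ (2 * d / t * (excess lam eps (c0 + t) x *
              min eps (excess lam eps (c0 + t) x)) + lam * δ') * (1 - assignProb k x d) :=
            mul_le_mul_of_nonneg_right h4 (by linarith)
        _ ≤ _ := mul_le_of_le_one_right hpos (by linarith)
  rw [expect_add, expect_const_mul, h.expect_const] at hw
  have h5 : 2 * d / t * ((12 * d ^ 3 / n) * ((12 * d ^ 3 / n) / (t / 4 * (t / 4)))) ≤ d / n := by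
    rw [div_le_iff₀ (by positivity)] at hnl
    have e : 2 * d / t * ((12 * d ^ 3 / n) * ((12 * d ^ 3 / n) / (t / 4 * (t / 4)))) =
        d / n * (32 * (12 * d ^ 3) ^ 2 / (n * t ^ 3)) := by
      field_simp
      ring
    rw [e]
    exact mul_le_of_le_one_right (by positivity) (div_le_one_of_le₀ hnl (by positivity))
  have h6 := mul_le_mul_of_nonneg_left hexc (by positivity : (0 : ℝ) ≤ 2 * d / t)
  have h7 := h.expect_sq_le hd hn hk hlam
  have h8 := mul_le_mul_of_nonneg_left (hw.trans (add_le_add_left (h6.trans h5) _)) hlam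
  refine h7.trans ?_
  have e : lam * (d / n + lam * δ') + d * lam / n = 2 * d / n * lam + lam ^ 2 * δ' := by ring
  linarith

/-- The second moment of the excess is small compared to `1 / (n * eps)` if `eps` is small and
`n * eps` is large. -/
theorem expect_excess_sq_le (h : IsStationary k lam π) (hd : 1 ≤ d) (hn : 1 ≤ n) (hk : k ≤ n)
    (hlam : 0 ≤ lam) (hlam1 : lam ≤ 1) (heps : 0 < eps) (hδ0 : 0 ≤ δ)
    (hδ : ∀ x : State n d, busyFrac x < lam + eps / 2 → 1 - assignProb k x d ≤ δ)
    {t : ℝ} (ht : 2 * d / n ≤ t) (hepst : eps ≤ t / 4) :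
    expect π (fun x => excess lam eps (((d : ℝ) - 1) * lam * δ) x ^ 2) ≤
      12 * d ^ 3 / (n * eps) * (2 * t + 16 * d * (12 * d ^ 3) / (n * eps * t)) := by
  have hd1 : (1 : ℝ) ≤ d := by exact_mod_cast hd
  have hn0 : (0 : ℝ) < n := by exact_mod_cast hn
  have ht0 : 0 < t := lt_of_lt_of_le (by positivity) ht
  have h1 := h.expect_excess_le_const hd hn hk hlam hlam1 heps hδ
  have h2 := h.expect_excess_add_le hd hn hk hlam hlam1 heps hδ ht
  rw [min_eq_left hepst] at h2
  set c0 := ((d : ℝ) - 1) * lam * δ with hc0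
  have hc00 : 0 ≤ c0 := mul_nonneg (mul_nonneg (by linarith) hlam) hδ0
  have hE : expect π (fun x => excess lam eps c0 x ^ 2) ≤ expect π (fun x =>
      2 * t / eps * (excess lam eps c0 x * min eps (excess lam eps c0 x)) +
      4 * d / eps * (excess lam eps (c0 + t) x * min eps (excess lam eps (c0 + t) x))) := by
    refine h.expect_mono fun x => ?_
    have p0 := excess_nonneg lam eps c0 x
    have p1 := excess_nonneg lam eps (c0 + t) x
    have a0 : 0 ≤ excess lam eps c0 x * min eps (excess lam eps c0 x) :=
      mul_nonneg p0 (le_min heps.le p0)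
    have a1 : 0 ≤ excess lam eps (c0 + t) x * min eps (excess lam eps (c0 + t) x) :=
      mul_nonneg p1 (le_min heps.le p1)
    have b0 : 0 ≤ 2 * t / eps * (excess lam eps c0 x * min eps (excess lam eps c0 x)) := by
      positivity
    have b1 : 0 ≤ 4 * d / eps *
      (excess lam eps (c0 + t) x * min eps (excess lam eps (c0 + t) x)) := by positivity
    rcases le_total (excess lam eps c0 x) (2 * t) with h3 | h3
    · refine le_trans ?_ (le_add_of_nonneg_right b1)
      rw [div_mul_eq_mul_div, le_div_iff₀ heps, sq]
      have : excess lam eps c0 x * eps ≤ 2 * t * min eps (excess lam eps c0 x) := by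
        rcases le_total eps (excess lam eps c0 x) with h4 | h4
        · rw [min_eq_left h4]
          exact mul_le_mul_of_nonneg_right h3 heps.le
        · rw [min_eq_right h4, mul_comm]
          exact mul_le_mul_of_nonneg_right (by linarith) p0
      nlinarith
    · refine le_trans ?_ (le_add_of_nonneg_left b0)
      have h4 := excess_le_excess_add (c := c0) (lam := lam) (eps := eps) hd ht0.le x
      have h5 := excess_le (n := n) hd hlam heps.le (by linarith : 0 ≤ c0 + t) x
      have h6 : min eps (excess lam eps (c0 + t) x) = eps := min_eq_left (by linarith)
      rw [h6]
      have h7 : excess lam eps c0 x ^ 2 ≤ (2 * excess lam eps (c0 + t) x) ^ 2 :=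
        pow_le_pow_left₀ p0 (by linarith) 2
      have e : 4 * d / eps * (excess lam eps (c0 + t) x * eps) =
          4 * d * excess lam eps (c0 + t) x := by
        field_simp
      rw [e]
      nlinarith
  rw [expect_add, expect_const_mul, expect_const_mul] at hE
  have h3 := mul_le_mul_of_nonneg_left h1 (by positivity : 0 ≤ 2 * t / eps)
  have h4 := mul_le_mul_of_nonneg_left h2 (by positivity : 0 ≤ 4 * d / eps)
  refine hE.trans ((add_le_add h3 h4).trans (le_of_eq ?_))
  field_simp
  ring

/-- The mean square bound for a load that tends to one: both the deficit and the fluctuations of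
the fraction of busy servers are small. -/
theorem expect_sq_le_of_small (h : IsStationary k lam π) (hd : 1 ≤ d) (hn : 1 ≤ n) (hk : k ≤ n)
    (heps : 0 < eps) (hle : lam = 1 - 2 * eps) (heps4 : eps ≤ 1 / 4) {δ' : ℝ} (hδ0 : 0 ≤ δ)
    (hδ1 : δ ≤ 1)
    (hδ : ∀ x : State n d, busyFrac x < lam + eps / 2 → 1 - assignProb k x d ≤ δ)
    (hδδ : 8 * (d : ℝ) ^ 4 * δ ≤ δ') {t : ℝ} (htd : 128 * d * (12 * d ^ 3) * t = 1)
    (hnd : 2 * d / n ≤ t) (hepst : eps ≤ t / 4)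
    (hne : 1024 * d ^ 2 * (12 * d ^ 3) ^ 2 / t ≤ (n : ℝ) * eps) :
    expect π (fun x => (lam - d * x.top hd) ^ 2) ≤
      2 * d / n * lam * (1 + 1 / eps) + lam ^ 2 * δ' := by
  have hd1 : (1 : ℝ) ≤ d := by exact_mod_cast hd
  have hn0 : (0 : ℝ) < n := by exact_mod_cast hn
  have ht0 : 0 < t := lt_of_lt_of_le (by positivity) hnd
  have hlam : 0 ≤ lam := by linarith
  have hlam1 : lam ≤ 1 := by linarith
  have hlam2 : 1 / 2 ≤ lam := by linarith
  have h1 := h.expect_excess_sq_le hd hn hk hlam hlam1 heps hδ0 hδ hnd hepst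
  have h2 := h.expect_busyFrac_sub_sq_le hd hn hk hlam hδ0 fun x hx =>
    (assignProb_top_le_one_sub_lossProb hd k hk x).trans (hδ x (by linarith))
  set c0 := ((d : ℝ) - 1) * lam * δ with hc0
  have hc00 : 0 ≤ c0 := mul_nonneg (mul_nonneg (by linarith) hlam) hδ0
  have h3 : expect π (fun x => (lam - d * x.top hd) ^ 2) ≤ expect π (fun x =>
      2 * ((d : ℝ) - 1) ^ 2 * deficit x ^ 2 + 2 * (busyFrac x - lam) ^ 2) := by
    refine h.expect_mono fun x => ?_
    have e1 := pow_le_pow_left₀ (busyFrac_sub_top_nonneg hd x) (busyFrac_sub_top_le hd x) 2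
    nlinarith [sq_nonneg ((busyFrac x - d * x.top hd) + (busyFrac x - lam))]
  have h4 : expect π (fun x => deficit x ^ 2) ≤
      expect π (fun x => 8 * excess lam eps c0 x ^ 2 + 2 * c0 ^ 2) := by
    refine h.expect_mono fun x => ?_
    have e1 := pow_le_pow_left₀ (deficit_nonneg x) (deficit_le hd lam eps c0 x) 2
    nlinarith [sq_nonneg (2 * excess lam eps c0 x - c0)]
  rw [expect_add, expect_const_mul, expect_const_mul] at h3
  rw [expect_add, expect_const_mul, h.expect_const] at h4
  have hQ : 0 ≤ expect π (fun x => deficit x ^ 2) := h.expect_nonneg fun x => sq_nonneg _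
  have h5 : expect π (fun x => (lam - d * x.top hd) ^ 2) ≤
      2 * d ^ 2 * expect π (fun x => deficit x ^ 2) + 4 * d * lam / n + 4 * lam ^ 2 * δ := by
    have e1 : (((d : ℝ) - 1) ^ 2 + 1) * expect π (fun x => deficit x ^ 2) ≤
        d ^ 2 * expect π (fun x => deficit x ^ 2) :=
      mul_le_mul_of_nonneg_right (by nlinarith) hQ
    have e2 : 2 * (2 * d * lam / n) = 4 * d * lam / n := by ring
    linarith
  have h6 : 2 * d ^ 2 * (8 * (12 * d ^ 3 / (n * eps) *
      (2 * t + 16 * d * (12 * d ^ 3) / (n * eps * t)))) ≤ d / (2 * (n * eps)) := by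
    have hne' : 16 * d * (12 * d ^ 3) / (n * eps * t) ≤ 1 / (64 * d * (12 * d ^ 3)) := by
      rw [div_le_iff₀ ht0] at hne
      rw [div_le_div_iff₀ (by positivity) (by positivity)]
      linarith
    have e2 : 2 * t = 1 / (64 * d * (12 * d ^ 3)) := by
      rw [eq_div_iff (by positivity)]
      linarith
    rw [← e2] at hne'
    calc _ ≤ 2 * (d : ℝ) ^ 2 * (8 * (12 * d ^ 3 / (n * eps) * (2 * t + 2 * t))) := by gcongr
      _ = d / (2 * (n * eps)) * (128 * d * (12 * d ^ 3) * t) := by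
        field_simp
        ring
      _ = d / (2 * (n * eps)) := by rw [htd, mul_one]
  have h7 : 4 * d ^ 2 * c0 ^ 2 + 4 * lam ^ 2 * δ ≤ lam ^ 2 * δ' := by
    have hl2 : 0 ≤ lam ^ 2 := sq_nonneg _
    have e1 : c0 ^ 2 ≤ lam ^ 2 * (d ^ 2 * δ) := by
      have e3 : ((d : ℝ) - 1) ^ 2 * δ ^ 2 ≤ d ^ 2 * δ :=
        mul_le_mul (by nlinarith) (by nlinarith) (by positivity) (by positivity)
      calc c0 ^ 2 = lam ^ 2 * (((d : ℝ) - 1) ^ 2 * δ ^ 2) := by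
            rw [hc0]
            ring
        _ ≤ _ := mul_le_mul_of_nonneg_left e3 hl2
    have e4 : (1 : ℝ) ≤ d ^ 4 := one_le_pow₀ hd1
    have e5 : δ ≤ d ^ 4 * δ := le_mul_of_one_le_left hδ0 e4
    calc 4 * d ^ 2 * c0 ^ 2 + 4 * lam ^ 2 * δ
        ≤ 4 * d ^ 2 * (lam ^ 2 * (d ^ 2 * δ)) + 4 * lam ^ 2 * (d ^ 4 * δ) := by gcongr
      _ = lam ^ 2 * (8 * d ^ 4 * δ) := by ring
      _ ≤ _ := mul_le_mul_of_nonneg_left hδδ hl2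
  have h8 : 4 * d * lam / n + d / (2 * (n * eps)) ≤ 2 * d / n * lam * (1 + 1 / eps) := by
    have e1 : 4 * d * lam / n + d / (2 * (n * eps)) =
        (d / (n * eps)) * (4 * lam * eps + 1 / 2) := by
      field_simp
    have e2 : 2 * d / n * lam * (1 + 1 / eps) = (d / (n * eps)) * (2 * lam * eps + 2 * lam) := by
      field_simp
    rw [e1, e2]
    refine mul_le_mul_of_nonneg_left ?_ (by positivity)
    have e3 := mul_le_mul_of_nonneg_left heps4 hlam
    linarith
  have hd2 : (0 : ℝ) ≤ 2 * d ^ 2 := by positivity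
  have h9 := mul_le_mul_of_nonneg_left (h4.trans (add_le_add_left
    (mul_le_mul_of_nonneg_left h1 (by norm_num : (0 : ℝ) ≤ 8)) (2 * c0 ^ 2))) hd2
  rw [mul_add] at h9
  refine h5.trans (le_trans (add_le_add_left (add_le_add_left
    (h9.trans (add_le_add_left h6 _)) _) _) ?_)
  refine le_trans (le_of_eq ?_) (add_le_add h8 h7)
  ring

end IsStationary

end AdaptiveJobs

namespace AdaptiveJobs

/-! ### The sampling term -/

/-- Half of the spare capacity `1 - λ(n)`. -/
noncomputable def halfSpare (α β : ℝ) (n : ℕ) : ℝ := β / (2 * (n : ℝ) ^ α)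

section

variable {α β : ℝ} {n : ℕ}

theorem halfSpare_pos (hβ : 0 < β) (hn : 1 ≤ n) : 0 < halfSpare α β n := by
  have : (0 : ℝ) < n := by exact_mod_cast hn
  unfold halfSpare
  positivity

theorem load_eq (hn : 1 ≤ n) : load α β n = 1 - 2 * halfSpare α β n := by
  have hn0 : (0 : ℝ) < n := by exact_mod_cast hn
  have : (0 : ℝ) < (n : ℝ) ^ α := by positivity
  unfold load halfSpare
  field_simp

theorem one_div_halfSpare : 1 / halfSpare α β n = 2 * (n : ℝ) ^ α / β := by
  rw [halfSpare, one_div_div]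

theorem samplingTerm_eq {d k : ℕ} (hdk : d ≤ k) :
    samplingTerm d α β n k = (k : ℝ) ^ d * (1 - halfSpare α β n) ^ (k - d) := by
  rw [samplingTerm, ← Nat.cast_sub hdk, zpow_natCast]
  rfl

theorem samplingTerm_nonneg {d k : ℕ} (h : halfSpare α β n ≤ 1) :
    0 ≤ samplingTerm d α β n k := by
  have : 0 ≤ 1 - β / (2 * (n : ℝ) ^ α) := sub_nonneg.mpr h
  unfold samplingTerm
  positivity

/-- With fewer than `d` sampled servers the exponent is negative and the bound is trivial. -/
theorem one_le_samplingTerm {d k : ℕ} (hk : 1 ≤ k) (hkd : k < d) (h0 : 0 ≤ halfSpare α β n)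
    (h : halfSpare α β n < 1) : 1 ≤ samplingTerm d α β n k := by
  have hk1 : (1 : ℝ) ≤ k := by exact_mod_cast hk
  have hb : (0 : ℝ) < 1 - halfSpare α β n := by linarith
  have h1 : 1 ≤ (1 - halfSpare α β n) ^ ((k : ℤ) - (d : ℤ)) :=
    one_le_zpow_of_nonpos₀ hb (sub_le_self 1 h0) (by omega)
  calc (1 : ℝ) = 1 * 1 := (one_mul 1).symm
    _ ≤ _ := mul_le_mul (one_le_pow₀ hk1) h1 zero_le_one (by positivity)

end

/-- Below the busy fraction `1 - 3 e / 2` the failure probability is smaller than the sampling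
term by a factor that beats `(d - 1) ^ 2`, since `(1 - 3 e / 2) ^ 2 ≤ (1 - e) ^ 3`. -/
theorem sq_mul_pow_le {d k : ℕ} (hd : 1 ≤ d) (hdk : d ≤ k) {e : ℝ} (he : e ≤ 1 / 2)
    (hS : d * ((k : ℝ) ^ d * (1 - e) ^ (k - d)) < 1) :
    ((d : ℝ) - 1) ^ 2 * (d * ((k : ℝ) ^ (d - 1) * (1 - 3 / 2 * e) ^ (k - d))) ≤
      d * ((k : ℝ) ^ d * (1 - e) ^ (k - d)) := by
  have hdR : (1 : ℝ) ≤ d := by exact_mod_cast hd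
  have hkR : (d : ℝ) ≤ k := by exact_mod_cast hdk
  set y := (1 - e) ^ (k - d) with hy
  set z := (1 - 3 / 2 * e) ^ (k - d) with hz
  have hy0 : 0 < y := pow_pos (by linarith) _
  have hz0 : 0 ≤ z := pow_nonneg (by linarith) _
  have hzy : z ^ 2 ≤ y ^ 3 := by
    rw [hz, hy, ← pow_mul, ← pow_mul, mul_comm _ 2, mul_comm _ 3, pow_mul, pow_mul]
    refine pow_le_pow_left₀ (sq_nonneg _) ?_ _
    have : 0 ≤ e ^ 2 * (3 / 4 - e) := mul_nonneg (sq_nonneg _) (by linarith)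
    nlinarith
  have hpow : (k : ℝ) ^ d = k ^ (d - 1) * k := by
    rw [← pow_succ, Nat.sub_add_cancel hd]
  have hmain : ((d : ℝ) - 1) ^ 2 * z ≤ k * y := by
    rcases hd.eq_or_lt with h1 | h2
    · rw [← h1]
      simp
      positivity
    refine (pow_le_pow_iff_left₀ (by positivity) (by positivity) two_ne_zero).mp ?_
    have h4 : ((d : ℝ) - 1) ^ 4 ≤ d * (k : ℝ) ^ d * k ^ 2 := by
      calc ((d : ℝ) - 1) ^ 4 ≤ (k : ℝ) ^ 4 := pow_le_pow_left₀ (by linarith) (by linarith) 4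
        _ = 1 * (k : ℝ) ^ 2 * k ^ 2 := by ring
        _ ≤ d * (k : ℝ) ^ d * k ^ 2 := by
          gcongr
          · linarith
          · exact h2
    calc (((d : ℝ) - 1) ^ 2 * z) ^ 2 = ((d : ℝ) - 1) ^ 4 * z ^ 2 := by ring
      _ ≤ (d * (k : ℝ) ^ d * k ^ 2) * y ^ 3 := by gcongr
      _ = (d * (k ^ d * y)) * (k * y) ^ 2 := by ring
      _ ≤ 1 * (k * y) ^ 2 := mul_le_mul_of_nonneg_right hS.le (sq_nonneg _)
      _ = (k * y) ^ 2 := one_mul _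
  calc ((d : ℝ) - 1) ^ 2 * (d * ((k : ℝ) ^ (d - 1) * z))
      = (d * (k : ℝ) ^ (d - 1)) * (((d : ℝ) - 1) ^ 2 * z) := by ring
    _ ≤ (d * (k : ℝ) ^ (d - 1)) * (k * y) := mul_le_mul_of_nonneg_left hmain (by positivity)
    _ = d * ((k : ℝ) ^ d * y) := by
      rw [hpow]
      ring

/-- If `e` is small and the sampling term is smaller than `1 / d ≤ 1 / 2`, then many servers are
sampled. -/
theorem le_of_samplingTerm_lt {d k K : ℕ} (hd : 2 ≤ d) (hdk : d ≤ k) {e : ℝ} (he0 : 0 ≤ e)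
    (he : K * e ≤ 1 / 2) (he1 : e ≤ 1) (hS : d * ((k : ℝ) ^ d * (1 - e) ^ (k - d)) < 1) :
    K ≤ k := by
  by_contra hlt
  push Not at hlt
  have hdR : (2 : ℝ) ≤ d := by exact_mod_cast hd
  have hk1 : (1 : ℝ) ≤ k := by exact_mod_cast (by omega : 1 ≤ k)
  have h1 : 1 / 2 ≤ (1 - e) ^ (k - d) := by
    have h2 := one_add_mul_le_pow (by linarith : (-2 : ℝ) ≤ -e) K
    have h3 : (1 - e) ^ K ≤ (1 - e) ^ (k - d) :=
      pow_le_pow_of_le_one (by linarith) (by linarith) (by omega)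
    have h4 : (1 + -e) ^ K = (1 - e) ^ K := by rw [← sub_eq_add_neg]
    linarith
  have h5 : (1 : ℝ) ≤ (k : ℝ) ^ d := one_le_pow₀ hk1
  have h6 : 1 * (1 / 2) ≤ (k : ℝ) ^ d * (1 - e) ^ (k - d) :=
    mul_le_mul h5 h1 (by norm_num) (by positivity)
  have h7 : 2 * (1 * (1 / 2)) ≤ d * ((k : ℝ) ^ d * (1 - e) ^ (k - d)) :=
    mul_le_mul hdR h6 (by norm_num) (by positivity)
  linarith

/-! ### The mean square bound -/

namespace IsStationary

variable {n d k : ℕ} {lam : ℝ} {π : State n d → ℝ}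

theorem expect_sq_le_trivial (h : IsStationary k lam π) (hd : 1 ≤ d) (hn : 1 ≤ n) (hk : k ≤ n)
    (hlam : 0 ≤ lam) :
    expect π (fun x => (lam - d * x.top hd) ^ 2) ≤ lam ^ 2 + d * lam / n := by
  have h1 := h.expect_sq_le hd hn hk hlam
  have h2 : expect π (fun x => (lam - d * x.top hd) * (1 - assignProb k x d)) ≤
      expect π (fun _ => lam) := by
    refine h.expect_mono fun x => ?_
    have ha : 0 ≤ d * x.top hd := mul_nonneg (Nat.cast_nonneg _) (top_nonneg hd x)
    have hA1 := assignProb_top_le_one k hk x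
    have hA0 := assignProb_nonneg k x d
    calc _ ≤ lam * (1 - assignProb k x d) :=
          mul_le_mul_of_nonneg_right (by linarith) (by linarith)
      _ ≤ lam := mul_le_of_le_one_right hlam (by linarith)
  rw [h.expect_const] at h2
  have h3 := mul_le_mul_of_nonneg_left h2 hlam
  rw [sq]
  linarith

/-- If every job occupies one server, then `d x_d` is the fraction of busy servers. -/
theorem expect_sq_le_of_eq_one (h : IsStationary k lam π) (hd : 1 ≤ d) (hd1 : d = 1)
    (hn : 1 ≤ n) (hk : k ≤ n) (hlam : 0 ≤ lam) {e δ' : ℝ} (he : 0 ≤ e) (hle : lam = 1 - 2 * e)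
    (hδ0 : 0 ≤ δ')
    (hδ' : ∀ x : State n d, busyFrac x ≤ 1 - e → 1 - assignProb k x d ≤ δ') :
    expect π (fun x => (lam - d * x.top hd) ^ 2) ≤ lam ^ 2 * δ' + d * lam / n := by
  have h1 := h.expect_sq_le hd hn hk hlam
  have h2 : expect π (fun x => (lam - d * x.top hd) * (1 - assignProb k x d)) ≤
      expect π (fun _ => lam * δ') := by
    refine h.expect_mono fun x => ?_
    have ha : 0 ≤ d * x.top hd := mul_nonneg (Nat.cast_nonneg _) (top_nonneg hd x)
    have hA1 := assignProb_top_le_one k hk x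
    rcases le_or_gt (busyFrac x) (1 - e) with hs | hs
    · exact mul_le_mul (by linarith) (hδ' x hs) (by linarith) hlam
    · have hr := busyFrac_sub_top_le hd x
      have h0 : ((d : ℝ) - 1) * deficit x = 0 := by
        have : (d : ℝ) = 1 := by exact_mod_cast hd1
        rw [this, sub_self, zero_mul]
      have : (lam - d * x.top hd) * (1 - assignProb k x d) ≤ 0 :=
        mul_nonpos_of_nonpos_of_nonneg (by linarith) (by linarith)
      exact this.trans (by positivity)
  rw [h.expect_const] at h2
  have h3 := mul_le_mul_of_nonneg_left h2 hlam
  have e : lam * (lam * δ') = lam ^ 2 * δ' := by ring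
  linarith

end IsStationary

theorem tendsto_halfSpare {α : ℝ} (hα : 0 < α) (β : ℝ) :
    Tendsto (halfSpare α β) atTop (𝓝 0) := by
  have h1 : Tendsto (fun n : ℕ => (n : ℝ) ^ α) atTop atTop :=
    (tendsto_rpow_atTop hα).comp tendsto_natCast_atTop_atTop
  exact (h1.const_mul_atTop two_pos).const_div_atTop β

theorem tendsto_mul_halfSpare {α β : ℝ} (hα : α < 1) (hβ : 0 < β) :
    Tendsto (fun n : ℕ => (n : ℝ) * halfSpare α β n) atTop atTop := by
  have h1 : Tendsto (fun n : ℕ => β / 2 * (n : ℝ) ^ (1 - α)) atTop atTop :=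
    ((tendsto_rpow_atTop (by linarith : 0 < 1 - α)).comp
      tendsto_natCast_atTop_atTop).const_mul_atTop (by positivity)
  refine h1.congr' ?_
  filter_upwards [eventually_ge_atTop 1] with n hn
  have hn0 : (0 : ℝ) < n := by exact_mod_cast hn
  rw [Real.rpow_sub hn0, Real.rpow_one, halfSpare]
  have : (0 : ℝ) < (n : ℝ) ^ α := by positivity
  field_simp

/-- The mean square bound, uniformly in the number of sampled servers. -/
theorem eventually_expect_sq_le (d : ℕ) (hd : 1 ≤ d) (α β : ℝ) (hα0 : 0 ≤ α) (hα1 : α < 1)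
    (hβ : 0 < β) : ∀ᶠ n : ℕ in atTop, 0 ≤ load α β n → ∀ k : ℕ, 1 ≤ k → k ≤ n →
      ∀ π : State n d → ℝ, IsStationary k (load α β n) π →
        expect π (fun x => (load α β n - d * x.top hd) ^ 2) ≤
          2 * (d : ℝ) / n * load α β n * (1 + 2 * (n : ℝ) ^ α / β) +
            load α β n ^ 2 * d * samplingTerm d α β n k := by
  have hdR : (1 : ℝ) ≤ d := by exact_mod_cast hd
  -- the requirements on `n` that depend on whether the load is fixed
  have hlarge : ∀ᶠ n : ℕ in atTop, α = 0 →
      2 * d / n ≤ halfSpare α β n / (4 * d) ∧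
        32 * (12 * d ^ 3) ^ 2 / (halfSpare α β n / (4 * d)) ^ 3 ≤ (n : ℝ) := by
    by_cases hα : α = 0
    · subst hα
      have hc : ∀ n : ℕ, halfSpare 0 β n = β / 2 := fun n => by simp [halfSpare]
      simp only [hc, forall_const]
      have h1 : Tendsto (fun n : ℕ => (2 * d : ℝ) / n) atTop (𝓝 0) :=
        tendsto_const_div_atTop_nhds_zero_nat _
      exact (h1.eventually_le_const (by positivity)).and
        (tendsto_natCast_atTop_atTop.eventually_ge_atTop _)
    · exact Eventually.of_forall fun n h => absurd h hα
  -- the fixed distance between the two thresholds for the deficit in the case `α > 0`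
  set t : ℝ := 1 / (128 * d * (12 * d ^ 3)) with ht
  have ht0 : 0 < t := by positivity
  have hsmall : ∀ᶠ n : ℕ in atTop, 0 < α →
      halfSpare α β n ≤ 1 / 4 ∧ halfSpare α β n ≤ t / 4 ∧
      ((8 * d ^ 4 : ℕ) : ℝ) * halfSpare α β n ≤ 1 / 2 ∧ 2 * d / n ≤ t ∧
      1024 * d ^ 2 * (12 * d ^ 3) ^ 2 / t ≤ (n : ℝ) * halfSpare α β n := by
    rcases hα0.eq_or_lt with hα | hα
    · exact Eventually.of_forall fun n h => absurd hα h.ne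
    · have h0 := tendsto_halfSpare hα β
      have h1 : Tendsto (fun n : ℕ => (2 * d : ℝ) / n) atTop (𝓝 0) :=
        tendsto_const_div_atTop_nhds_zero_nat _
      have h2 := h0.const_mul ((8 * d ^ 4 : ℕ) : ℝ)
      rw [mul_zero] at h2
      filter_upwards [h0.eventually_le_const (by norm_num : (0 : ℝ) < 1 / 4),
        h0.eventually_le_const (by positivity : (0 : ℝ) < t / 4),
        h2.eventually_le_const (by norm_num : (0 : ℝ) < 1 / 2),
        h1.eventually_le_const ht0,
        (tendsto_mul_halfSpare hα1 hβ).eventually_ge_atTop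
          (1024 * d ^ 2 * (12 * d ^ 3) ^ 2 / t)] with n a1 a2 a3 a4 a5 _
      exact ⟨a1, a2, a3, a4, a5⟩
  filter_upwards [hlarge, hsmall, eventually_ge_atTop 1] with n hnl hns hn hlam k hk1 hkn π hπ
  have hn0 : (0 : ℝ) < n := by exact_mod_cast hn
  have he0 := halfSpare_pos (α := α) hβ hn
  have hle := load_eq (α := α) (β := β) hn
  rw [← one_div_halfSpare]
  set e := halfSpare α β n with hedef
  set lam := load α β n
  have he : e ≤ 1 / 2 := by linarith
  have hinv : 0 ≤ 1 / e := by positivity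
  have hS0 : 0 ≤ samplingTerm d α β n k := samplingTerm_nonneg (by linarith)
  have hbase : d * lam / n ≤ 2 * d / n * lam * (1 + 1 / e) := by
    have e1 : 2 * d / n * lam * (1 + 1 / e) = d * lam / n * (2 * (1 + 1 / e)) := by ring
    rw [e1]
    exact le_mul_of_one_le_right (by positivity) (by linarith)
  rw [mul_assoc (lam ^ 2)]
  rcases le_or_gt 1 (d * samplingTerm d α β n k) with hbig | hS
  · have h1 := hπ.expect_sq_le_trivial hd hn hkn hlam
    have h2 := le_mul_of_one_le_right (sq_nonneg lam) hbig
    linarith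
  have hdk : d ≤ k := by
    by_contra hlt
    have h1 := one_le_samplingTerm (α := α) (β := β) (n := n) hk1 (not_le.mp hlt) he0.le
      (by linarith)
    have h2 : 1 * 1 ≤ d * samplingTerm d α β n k :=
      mul_le_mul hdR h1 zero_le_one (by positivity)
    linarith
  rw [samplingTerm_eq hdk] at hS ⊢
  rw [← hedef] at hS ⊢
  set δ' := d * ((k : ℝ) ^ d * (1 - e) ^ (k - d)) with hδ'def
  set δ := d * ((k : ℝ) ^ (d - 1) * (1 - 3 / 2 * e) ^ (k - d)) with hδdef
  have hkR : (1 : ℝ) ≤ k := by exact_mod_cast hk1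
  have hb : 0 ≤ 1 - e := by linarith
  have hb2 : 0 ≤ 1 - 3 / 2 * e := by linarith
  have hδ0 : 0 ≤ δ := by positivity
  have hδ'0 : 0 ≤ δ' := by positivity
  have hδ : ∀ x : State n d, busyFrac x < lam + e / 2 → 1 - assignProb k x d ≤ δ := by
    intro x hx
    rw [busyFrac_eq] at hx
    exact one_sub_assignProb_top_le hd hkn hdk x (by linarith) (by linarith)
  have hδ' : ∀ x : State n d, busyFrac x ≤ 1 - e → 1 - assignProb k x d ≤ δ' := by
    intro x hx
    rw [busyFrac_eq] at hx
    refine (one_sub_assignProb_top_le hd hkn hdk x hx (by linarith)).trans ?_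
    have : (k : ℝ) ^ (d - 1) ≤ (k : ℝ) ^ d := pow_le_pow_right₀ hkR (Nat.sub_le d 1)
    rw [hδ'def]
    gcongr
  rcases hα0.eq_or_lt with hα | hα
  · obtain ⟨a1, a2⟩ := hnl hα.symm
    have h1 := hπ.expect_sq_le_of_fixed hd hn hkn hlam he0 hle hδ0 hδ hδ'
      (sq_mul_pow_le hd hdk he hS) a1 a2
    have h2 : 2 * d / n * lam ≤ 2 * d / n * lam * (1 + 1 / e) :=
      le_mul_of_one_le_right (by positivity) (by linarith)
    linarith
  rcases hd.eq_or_lt with hd1 | hd2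
  · have h1 := hπ.expect_sq_le_of_eq_one hd hd1.symm hn hkn hlam he0.le hle hδ'0 hδ'
    linarith
  · obtain ⟨a1, a2, a3, a4, a5⟩ := hns hα
    have hK := le_of_samplingTerm_lt hd2 hdk he0.le a3 (by linarith) hS
    have hKR : 8 * (d : ℝ) ^ 4 ≤ k := by exact_mod_cast hK
    have hδδ : 8 * (d : ℝ) ^ 4 * δ ≤ δ' := by
      have hpow : (k : ℝ) ^ d = k ^ (d - 1) * k := by rw [← pow_succ, Nat.sub_add_cancel hd]
      calc 8 * (d : ℝ) ^ 4 * δ ≤ k * δ := mul_le_mul_of_nonneg_right hKR hδ0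
        _ = d * ((k : ℝ) ^ d * (1 - 3 / 2 * e) ^ (k - d)) := by
          rw [hδdef, hpow]
          ring
        _ ≤ δ' := by
          have : 1 - 3 / 2 * e ≤ 1 - e := by linarith
          rw [hδ'def]
          gcongr
    have hδ1 : δ ≤ 1 := by
      have h4 : (1 : ℝ) ≤ 8 * (d : ℝ) ^ 4 := by
        have := one_le_pow₀ (n := 4) hdR
        linarith
      have := le_mul_of_one_le_left hδ0 h4
      linarith
    refine hπ.expect_sq_le_of_small hd hn hkn he0 hle a1 hδ0 hδ1 hδ hδδ ?_ a4 a2 a5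
    rw [ht]
    field_simp

/-! ### State space collapse -/

/-- The mean number of servers that are busy with jobs of less than maximal parallelism is
controlled by the mean square error. -/
theorem IsStationary.expect_scaled_le {n d k : ℕ} {lam : ℝ} {π : State n d → ℝ}
    (h : IsStationary k lam π) (hd : 1 ≤ d) (hn : 1 ≤ n) (hk : k ≤ n) (hlam : 0 ≤ lam) {i : Fin d}
    (hi : (i : ℕ) + 1 < d) : expect π (fun x => x.scaled i) ≤
      √(expect π (fun x => (lam - d * x.top hd) ^ 2)) := by
  refine Real.le_sqrt_of_sq_le (le_trans ?_ (h.sq_expect_le _))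
  refine pow_le_pow_left₀ (h.expect_nonneg fun x => scaled_nonneg x i) ?_ 2
  have h1 := h.expect_busyFrac hd hn hk
  have h2 : expect π (fun x => x.scaled i) ≤ expect π (fun x => (lam - d * x.top hd) -
      (lam * (1 - lossProb k x) - busyFrac x)) := by
    refine h.expect_mono fun x => ?_
    have h3 := scaled_le_busyFrac_sub_top hd x hi
    have h4 := mul_nonneg hlam (lossProb_nonneg k x)
    linarith
  rwa [expect_sub, h1, sub_zero] at h2

theorem tendsto_two_mul_div_mul {α β : ℝ} (hα : α < 1) (hβ : 0 < β) (d : ℕ) :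
    Tendsto (fun n : ℕ => 2 * (d : ℝ) / n * (1 + 2 * (n : ℝ) ^ α / β)) atTop (𝓝 0) := by
  have h1 : Tendsto (fun n : ℕ => 2 * (d : ℝ) / n) atTop (𝓝 0) :=
    tendsto_const_div_atTop_nhds_zero_nat _
  have h2 := (tendsto_mul_halfSpare hα hβ).const_div_atTop (2 * (d : ℝ))
  have h3 := h1.add h2
  rw [add_zero] at h3
  refine h3.congr fun n => ?_
  rw [← one_div_halfSpare]
  ring

/-- A sample size of `C n^α log n` with `C > 2 α d / β` makes the sampling term vanish: up to
constants it is `n^(α d) y^d e^(-y)` for `y = β k / (2 n^α) ≥ (β C / 2) log n`. -/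
theorem tendsto_samplingTerm {d : ℕ} {α β : ℝ} (hα0 : 0 ≤ α) (hβ : 0 < β)
    (hload : ∀ᶠ n : ℕ in atTop, 0 ≤ load α β n) {k : ℕ → ℕ} {C : ℝ} (hC : 2 * α * d / β < C)
    (hk : ∀ᶠ n : ℕ in atTop, C * (n : ℝ) ^ α * Real.log n ≤ k n) :
    Tendsto (fun n : ℕ => samplingTerm d α β n (k n)) atTop (𝓝 0) := by
  set γ := β * C / 2 with hγ
  have hαd : 0 ≤ α * d := by positivity
  have hγd : α * d < γ := by
    rw [div_lt_iff₀ hβ] at hC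
    rw [hγ]
    linarith
  have hγ0 : 0 < γ := by linarith
  obtain ⟨r, hr1, hr2⟩ := exists_between hγd
  set θ := r / γ with hθ
  have hθ1 : 0 < 1 - θ := by
    rw [hθ, sub_pos, div_lt_one hγ0]
    exact hr2
  have hθ0 : 0 ≤ θ := div_nonneg (by linarith) hγ0.le
  set y : ℕ → ℝ := fun n => halfSpare α β n * k n with hy
  have hylog : ∀ᶠ n : ℕ in atTop, γ * Real.log n ≤ y n := by
    filter_upwards [hk, eventually_ge_atTop 1] with n hkn hn
    have hn0 : (0 : ℝ) < n := by exact_mod_cast hn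
    have hp : (0 : ℝ) < (n : ℝ) ^ α := by positivity
    have h1 := mul_le_mul_of_nonneg_left hkn (halfSpare_pos (α := α) hβ hn).le
    refine le_trans (le_of_eq ?_) h1
    rw [hγ, halfSpare]
    field_simp
  have hyt : Tendsto y atTop atTop :=
    tendsto_atTop_mono' _ hylog
      ((Real.tendsto_log_atTop.comp tendsto_natCast_atTop_atTop).const_mul_atTop hγ0)
  have hlim : Tendsto (fun n => (2 : ℝ) ^ d * (2 / β) ^ d *
      ((y n) ^ (d : ℝ) * Real.exp (-(1 - θ) * y n))) atTop (𝓝 0) := by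
    have := ((tendsto_rpow_mul_exp_neg_mul_atTop_nhds_zero (d : ℝ) (1 - θ) hθ1).comp
      hyt).const_mul ((2 : ℝ) ^ d * (2 / β) ^ d)
    rwa [mul_zero] at this
  refine tendsto_of_tendsto_of_tendsto_of_le_of_le' tendsto_const_nhds hlim ?_ ?_
  · filter_upwards [hload, eventually_ge_atTop 1] with n hl hn
    have := load_eq (α := α) (β := β) hn
    have := halfSpare_pos (α := α) hβ hn
    exact samplingTerm_nonneg (by linarith)
  · filter_upwards [hload, hylog, eventually_ge_atTop 1] with n hl hyn hn
    have hn0 : (0 : ℝ) < n := by exact_mod_cast hn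
    have hn1 : (1 : ℝ) ≤ n := by exact_mod_cast hn
    have hle := load_eq (α := α) (β := β) hn
    have he0 := halfSpare_pos (α := α) hβ hn
    have hp : (0 : ℝ) < (n : ℝ) ^ α := by positivity
    set e := halfSpare α β n with hedef
    have he : 1 / 2 ≤ 1 - e := by linarith
    have hb : 0 < 1 - e := by linarith
    have hS : samplingTerm d α β n (k n) =
        (k n : ℝ) ^ d * ((1 - e) ^ (k n) * ((1 - e) ^ d)⁻¹) := by
      change (k n : ℝ) ^ d * (1 - e) ^ ((k n : ℤ) - (d : ℤ)) = _
      rw [zpow_sub₀ hb.ne', zpow_natCast, zpow_natCast, div_eq_mul_inv]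
    have h1 : ((1 - e) ^ d)⁻¹ ≤ (2 : ℝ) ^ d := by
      rw [← inv_pow]
      refine pow_le_pow_left₀ (by positivity) ?_ d
      rw [inv_le_comm₀ hb two_pos]
      linarith
    have h2 : (1 - e) ^ (k n) ≤ Real.exp (-(y n)) := by
      have h3 : 1 - e ≤ Real.exp (-e) := by
        have := Real.add_one_le_exp (-e)
        linarith
      refine (pow_le_pow_left₀ hb.le h3 _).trans (le_of_eq ?_)
      rw [← Real.exp_nat_mul]
      congr 1
      rw [hy]
      ring
    have h3 : Real.exp (-(y n)) ≤ Real.exp (-(1 - θ) * y n) * (n : ℝ) ^ (-(α * d)) := by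
      rw [Real.rpow_def_of_pos hn0, ← Real.exp_add, Real.exp_le_exp]
      have hlog : 0 ≤ Real.log n := Real.log_nonneg hn1
      have h4 := mul_le_mul_of_nonneg_left hyn hθ0
      have h5 : θ * (γ * Real.log n) = r * Real.log n := by
        rw [hθ]
        field_simp
      have h6 : α * d * Real.log n ≤ r * Real.log n := mul_le_mul_of_nonneg_right hr1.le hlog
      linarith
    have h4 : (k n : ℝ) ^ d = (2 / β) ^ d * (n : ℝ) ^ (α * d) * (y n) ^ d := by
      rw [Real.rpow_mul hn0.le, Real.rpow_natCast, ← mul_pow, ← mul_pow]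
      congr 1
      simp only [hy]
      rw [halfSpare]
      field_simp
    have hy0 : 0 ≤ y n := by positivity
    have hnn : (n : ℝ) ^ (α * d) * (n : ℝ) ^ (-(α * d)) = 1 := by
      rw [← Real.rpow_add hn0, add_neg_cancel, Real.rpow_zero]
    calc samplingTerm d α β n (k n)
        ≤ (k n : ℝ) ^ d * ((Real.exp (-(1 - θ) * y n) * (n : ℝ) ^ (-(α * d))) * 2 ^ d) := by
          rw [hS]
          exact mul_le_mul_of_nonneg_left
            (mul_le_mul (h2.trans h3) h1 (by positivity) (by positivity)) (by positivity)
      _ = 2 ^ d * (2 / β) ^ d * ((y n) ^ d * Real.exp (-(1 - θ) * y n)) *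
            ((n : ℝ) ^ (α * d) * (n : ℝ) ^ (-(α * d))) := by
          rw [h4]
          ring
      _ = _ := by rw [hnn, mul_one, Real.rpow_natCast]

end AdaptiveJobs

theorem mainTheorem4 (d : ℕ) (hd : 1 ≤ d) (α β : ℝ) (hα0 : 0 ≤ α) (hα1 : α < 1) (hβ : 0 < β)
    (hload : ∀ᶠ n : ℕ in atTop, 0 ≤ AdaptiveJobs.load α β n)
    (k : ℕ → ℕ) (hk : ∀ᶠ n : ℕ in atTop, 1 ≤ k n ∧ k n ≤ n) :
    (∀ᶠ n : ℕ in atTop, ∀ π : AdaptiveJobs.State n d → ℝ,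
      AdaptiveJobs.IsStationary (k n) (AdaptiveJobs.load α β n) π →
        AdaptiveJobs.expect π (fun x => (AdaptiveJobs.load α β n - d * x.top hd) ^ 2) ≤
          2 * (d : ℝ) / n * AdaptiveJobs.load α β n * (1 + 2 * (n : ℝ) ^ α / β) +
            AdaptiveJobs.load α β n ^ 2 * d * AdaptiveJobs.samplingTerm d α β n (k n)) ∧
    (Tendsto (fun n : ℕ => AdaptiveJobs.samplingTerm d α β n (k n)) atTop (𝓝 0) →
      ∀ π : (n : ℕ) → AdaptiveJobs.State n d → ℝ,
        (∀ᶠ n : ℕ in atTop,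
          AdaptiveJobs.IsStationary (k n) (AdaptiveJobs.load α β n) (π n)) →
        Tendsto (fun n : ℕ => AdaptiveJobs.expect (π n)
          (fun x => (AdaptiveJobs.load α β n - d * x.top hd) ^ 2)) atTop (𝓝 0) ∧
        ∀ i : Fin d, (i : ℕ) + 1 < d →
          Tendsto (fun n : ℕ => AdaptiveJobs.expect (π n) (fun x => x.scaled i)) atTop (𝓝 0)) ∧
    (∀ C : ℝ, 2 * α * d / β < C → (∀ᶠ n : ℕ in atTop, C * (n : ℝ) ^ α * Real.log n ≤ k n) →
      Tendsto (fun n : ℕ => AdaptiveJobs.samplingTerm d α β n (k n)) atTop (𝓝 0)) := by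
  have hbound := AdaptiveJobs.eventually_expect_sq_le d hd α β hα0 hα1 hβ
  refine ⟨?_, fun hS π hπ => ?_, fun C hC hkC =>
    AdaptiveJobs.tendsto_samplingTerm hα0 hβ hload hC hkC⟩
  · filter_upwards [hbound, hload, hk] with n h1 h2 h3
    exact h1 h2 (k n) h3.1 h3.2
  have hsq : Tendsto (fun n : ℕ => AdaptiveJobs.expect (π n)
      (fun x => (AdaptiveJobs.load α β n - d * x.top hd) ^ 2)) atTop (𝓝 0) := by
    have hlim := (AdaptiveJobs.tendsto_two_mul_div_mul hα1 hβ d).add (hS.const_mul (d : ℝ))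
    rw [mul_zero, add_zero] at hlim
    refine tendsto_of_tendsto_of_tendsto_of_le_of_le' tendsto_const_nhds hlim ?_ ?_
    · filter_upwards [hπ] with n hn
      exact hn.expect_nonneg fun x => sq_nonneg _
    · filter_upwards [hbound, hload, hk, hπ, eventually_ge_atTop 1] with n h1 h2 h3 h4 h5
      have he0 := AdaptiveJobs.halfSpare_pos (α := α) hβ h5
      have hle := AdaptiveJobs.load_eq (α := α) (β := β) h5
      have hl1 : AdaptiveJobs.load α β n ≤ 1 := by linarith
      have hS0 : 0 ≤ AdaptiveJobs.samplingTerm d α β n (k n) :=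
        AdaptiveJobs.samplingTerm_nonneg (by linarith)
      refine (h1 h2 (k n) h3.1 h3.2 (π n) h4).trans (add_le_add ?_ ?_)
      · rw [mul_right_comm]
        exact mul_le_of_le_one_right (by positivity) hl1
      · rw [mul_assoc]
        exact mul_le_of_le_one_left (by positivity) (pow_le_one₀ h2 hl1)
  refine ⟨hsq, fun i hi => ?_⟩
  have hsqrt := (Real.continuous_sqrt.tendsto 0).comp hsq
  rw [Real.sqrt_zero] at hsqrt
  refine tendsto_of_tendsto_of_tendsto_of_le_of_le' tendsto_const_nhds hsqrt ?_ ?_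
  · filter_upwards [hπ] with n hn
    exact hn.expect_nonneg fun x => AdaptiveJobs.scaled_nonneg x i
  · filter_upwards [hload, hk, hπ, eventually_ge_atTop 1] with n h2 h3 h4 h5
    exact h4.expect_scaled_le hd h5 h3.2 h2 hi
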